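/- Deterministic machines. A deterministic enumerating machine $D$ takes a finite binary string as input, runs forever (it need not halt) and outputs natural numbers from time to time; on each input it thus enumerates a finite or infinite subset of $\mathbb N$. For $S\subseteq\mathbb N$ let $I_D(S)$ be the minimal length of an input on which $D$ enumerates exactly $S$ ($I_D(S)=\infty$ if there is none). A machine $D_0$ is universal if for every machine $D$ there is a constant $c$ with $I_{D_0}(S)\le I_D(S)+c$ for all $S\subseteq\mathbb N$. Fix a universal machine $D_0$ and write $I=I_{D_0}$. Probabilistic machines. A probabilistic enumerating machine $M$ has no input, may request arbitrarily many independent uniformly distributed random bits, one after another, and enumerates a subset of $\mathbb N$ that depends on these bits. Let $H_M(S)=-\log_2\Pr(M\text{ enumerates exactly }S)$, with $H_M(S)=\infty$ if this probability is $0$; the probability is with respect to the uniform measure on infinite bit sequences. A machine $M_0$ is optimal if for every probabilistic machine $M$ there is a constant $c$ with $H_{M_0}(S)\le H_M(S)+c$ for all $S\subseteq\mathbb N$. Fix an optimal machine $M_0$ and write $H=H_{M_0}$. Theorem. Let $\alpha\ge 1$ be a real number. Suppose that there is a constant $C$ such that every finite set $S\subset\mathbb N$ with $H(S)<\infty$ satisfies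 $$I(S)\le \alpha\cdot H(S)+C\log_2(H(S)+2).$$ Then there is a constant $C'$ such that every infinite set $S\subseteq\mathbb N$ with $H(S)<\infty$ satisfies $$I(S)\le \alpha\cdot H(S)+C'\log_2(H(S)+2).$$ -/

import Mathlib

open MeasureTheory
open scoped ENNReal

/-- A deterministic enumerating machine. Configurations are coded by natural numbers. The machine
receives a finite binary string `x`, starts in the configuration `init x`, and passes from a
configuration `c` to the configuration `step c`, forever. In a configuration `c` with
`out c = some n` it outputs the number `n`; in one with `out c = none` it outputs nothing.
All three functions are computable. (A machine that stops is one that stays forever in a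
configuration without output.) -/
structure EnumMachine where
  init : List Bool → ℕ
  step : ℕ → ℕ
  out : ℕ → Option ℕ
  computable_init : Computable init
  computable_step : Computable step
  computable_out : Computable out

namespace EnumMachine

/-- The configuration of `D` on the input `x` after `t` steps. -/
def config (D : EnumMachine) (x : List Bool) : ℕ → ℕ
  | 0 => D.init x
  | t + 1 => D.step (D.config x t)

/-- The set of all numbers that `D` ever outputs on the input `x`. -/
def enumerated (D : EnumMachine) (x : List Bool) : Set ℕ :=
  {n | ∃ t, D.out (D.config x t) = some n}

/-- `I_D(S)`: the minimal length of an input on which `D` enumerates exactly `S`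
(`⊤` if there is no such input). -/
noncomputable def complexity (D : EnumMachine) (S : Set ℕ) : ℕ∞ :=
  ⨅ x : {x : List Bool // D.enumerated x = S}, (x.1.length : ℕ∞)

/-- `D₀` is universal: it is optimal up to an additive constant among all deterministic
enumerating machines. -/
def IsUniversal (D₀ : EnumMachine) : Prop :=
  ∀ D : EnumMachine, ∃ c : ℕ, ∀ S : Set ℕ, D₀.complexity S ≤ D.complexity S + c

end EnumMachine

/-- The uniform measure on the Cantor space `ℕ → Bool`: independent fair bits. -/
noncomputable def coinMeasure : Measure (ℕ → Bool) :=
  Measure.infinitePi fun _ : ℕ => (PMF.uniformOfFintype Bool).toMeasure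

/-- A probabilistic enumerating machine. Configurations are coded by natural numbers and the
machine starts in the configuration `start`. In a configuration `c` it outputs `n` if
`out c = some n` (and nothing if `out c = none`). Then, if `step c = Sum.inl d`, it passes to `d`
without using randomness; if `step c = Sum.inr (d₀, d₁)`, it requests the next random bit and
passes to `d₀` if that bit is `0` and to `d₁` if it is `1`. -/
structure ProbEnumMachine where
  start : ℕ
  step : ℕ → ℕ ⊕ (ℕ × ℕ)
  out : ℕ → Option ℕ
  computable_step : Computable step
  computable_out : Computable out

namespace ProbEnumMachine

/-- The configuration of `M` after `t` steps with the random bits `w`, together with the number of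
random bits requested so far. -/
def run (M : ProbEnumMachine) (w : ℕ → Bool) : ℕ → ℕ × ℕ
  | 0 => (M.start, 0)
  | t + 1 =>
    match M.step (M.run w t).1 with
    | Sum.inl d => (d, (M.run w t).2)
    | Sum.inr (d₀, d₁) => (if w (M.run w t).2 then d₁ else d₀, (M.run w t).2 + 1)

/-- The set of all numbers that `M` ever outputs with the random bits `w`. -/
def enumerated (M : ProbEnumMachine) (w : ℕ → Bool) : Set ℕ :=
  {n | ∃ t, M.out (M.run w t).1 = some n}

/-- The probability that `M` enumerates exactly the set `S`. -/
noncomputable def prob (M : ProbEnumMachine) (S : Set ℕ) : ℝ≥0∞ :=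
  coinMeasure {w | M.enumerated w = S}

open Classical in
/-- `H_M(S) = -log₂ Pr(M enumerates S)`, and `⊤` if this probability is zero. -/
noncomputable def complexity (M : ProbEnumMachine) (S : Set ℕ) : EReal :=
  if M.prob S = 0 then ⊤ else ((-Real.logb 2 (M.prob S).toReal : ℝ) : EReal)

/-- `M₀` is optimal: `H_{M₀}` is minimal up to an additive constant among all probabilistic
enumerating machines. -/
def IsOptimal (M₀ : ProbEnumMachine) : Prop :=
  ∀ M : ProbEnumMachine, ∃ c : ℝ, ∀ S : Set ℕ, M₀.complexity S ≤ M.complexity S + (c : EReal)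

end ProbEnumMachine

/-! ### Outputs of machines as computable functions, and their primitive recursive approximations -/

/-! Let `h = ⌈H(S)⌉` and let `k` be the length bound wanted for `S`. Simulate the optimal machine on
all random words, but hold its outputs back: the finite set assigned to a word is replaced by the
numbers below `n` seen on that word only when at least a fraction `2 ^ (-h - 1)` of all words
receive the same set. Every newly assigned set is therefore likely.

A single machine `P` reads `h` and `k` in self-delimiting form and emits held-back sets stage by
stage, leaving a stage once each set in its table has been seen as the current output of `D` on an
input of length at most `k`. If `P` were stuck at a stage, some unmatched set would be newly
assigned (or be the initial empty set), so `P` would enumerate it with probability at least `2 ^ (-h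
- O(log (h + k)))` (`exists_le_coinMeasure_of_stage_eq`). The assumption on finite sets would then
give an input of length at most `k` for it, since `k = αh + O(log h)` with a large enough constant
(`exists_bound_const`). So no stage is permanent and every held-back set is matched.

If `S` is infinite, continuity of measure yields random bits producing `S` along which the held-back
sets are unbounded (`exists_held_unbounded`). These sets exhaust `S`. One of the finitely many
inputs of length at most `k` matches infinitely many of them; unboundedness forces the matching
times to infinity, so this input enumerates exactly `S` (`exists_outputSet_eq`).

Outputs enter only through primitive recursive approximations, which makes the tables and stages
primitive recursive. -/

theorem Computable.exists_primrec_approx {α : Type*} [Primcodable α] {f : α → Option ℕ}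
    (hf : Computable f) :
    ∃ a : ℕ → α → Option ℕ, Primrec₂ a ∧
      (∀ i j z y, i ≤ j → a i z = some y → a j z = some y) ∧
      ∀ z y, f z = some y ↔ ∃ i, a i z = some y := by
  have hp : Partrec fun z => (f z : Part ℕ) := Computable.ofOption hf
  obtain ⟨c, hc⟩ := Nat.Partrec.Code.exists_code.1 hp
  have hcz : ∀ z, c.eval (Encodable.encode z) = (f z : Part ℕ) := by
    intro z
    rw [hc]
    simp [Encodable.encodek]
    cases f z <;> simp
  refine ⟨fun i z => c.evaln i (Encodable.encode z), ?_, ?_, ?_⟩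
  · exact Nat.Partrec.Code.primrec_evaln.comp
      ((Primrec.fst.pair (Primrec.const c)).pair (Primrec.encode.comp Primrec.snd))
  · intro i j z y hij h
    exact Nat.Partrec.Code.evaln_mono hij h
  · intro z y
    have := @Nat.Partrec.Code.evaln_complete c (Encodable.encode z) y
    rw [hcz] at this
    simpa using this

namespace EnumMachine

theorem computable_config (D : EnumMachine) :
    Computable fun p : List Bool × ℕ => D.config p.1 p.2 := by
  have h : Computable fun p : List Bool × ℕ =>
      (Nat.rec (D.init p.1) (fun _ c => D.step c) p.2 : ℕ) :=
    Computable.nat_rec Computable.snd (D.computable_init.comp Computable.fst)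
      ((D.computable_step.comp (Computable.snd.comp Computable.snd)).to₂)
  refine h.of_eq ?_
  rintro ⟨x, t⟩
  induction t with
  | zero => rfl
  | succ t ih => simp only [config]; rw [← ih]

theorem computable_output (D : EnumMachine) :
    Computable fun p : List Bool × ℕ => D.out (D.config p.1 p.2) :=
  D.computable_out.comp D.computable_config

end EnumMachine

/-! ### Finite prefixes of the random bits and runs of probabilistic machines -/

/-- The first `n` bits of `w`. -/
def bitPrefix (w : ℕ → Bool) (n : ℕ) : List Bool := (List.range n).map w

@[simp] theorem length_bitPrefix (w : ℕ → Bool) (n : ℕ) : (bitPrefix w n).length = n := by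
  simp [bitPrefix]

theorem bitPrefix_succ (w : ℕ → Bool) (n : ℕ) : bitPrefix w (n + 1) = bitPrefix w n ++ [w n] := by
  simp [bitPrefix, List.range_succ]

theorem take_bitPrefix (w : ℕ → Bool) {m n : ℕ} (h : m ≤ n) :
    (bitPrefix w n).take m = bitPrefix w m := by
  simp [bitPrefix, ← List.map_take, List.take_range, h]

theorem bitPrefix_add (w : ℕ → Bool) (m n : ℕ) :
    bitPrefix w (m + n) = bitPrefix w m ++ bitPrefix (fun j => w (m + j)) n := by
  simp [bitPrefix, List.range_add, Function.comp_def]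

theorem getD_bitPrefix (w : ℕ → Bool) {n j : ℕ} (h : j < n) :
    (bitPrefix w n).getD j false = w j := by
  simp [bitPrefix, List.getD, h]

namespace ProbEnumMachine

/-- At most one bit is requested per step, so the first `t` bits determine the run up to time `t`.
-/
theorem run_snd_le (M : ProbEnumMachine) (w : ℕ → Bool) (t : ℕ) : (M.run w t).2 ≤ t := by
  induction t with
  | zero => simp [run]
  | succ t ih =>
    simp only [run]
    split <;> simp <;> omega

theorem run_congr (M : ProbEnumMachine) {v w : ℕ → Bool} {t : ℕ} (h : ∀ j < t, v j = w j) :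
    M.run v t = M.run w t := by
  induction t with
  | zero => rfl
  | succ t ih =>
    have ih := ih fun j hj => h j (by omega)
    have hb := h (M.run w t).2 (by have := M.run_snd_le w t; omega)
    simp only [run, ih, hb]

/-- The output of `M` at the time `|σ|` if the random bits start with `σ`. -/
def outputAfter (M : ProbEnumMachine) (σ : List Bool) : Option ℕ :=
  M.out (M.run (fun j => σ.getD j false) σ.length).1

theorem outputAfter_bitPrefix (M : ProbEnumMachine) (w : ℕ → Bool) (t : ℕ) :
    M.outputAfter (bitPrefix w t) = M.out (M.run w t).1 := by
  rw [outputAfter, length_bitPrefix, M.run_congr fun j hj => getD_bitPrefix w hj]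

theorem computable_outputAfter (M : ProbEnumMachine) : Computable M.outputAfter := by
  have hbit : Computable fun p : (List Bool × ℕ × ℕ × ℕ) × ℕ × ℕ =>
      p.1.1.getD p.1.2.2.2 false :=
    ((Primrec.list_getD false).comp (Primrec.fst.comp Primrec.fst)
      (Primrec.snd.comp (Primrec.snd.comp (Primrec.snd.comp Primrec.fst)))).to_comp
  have hcnt : Computable fun p : List Bool × ℕ × ℕ × ℕ => p.2.2.2 :=
    Computable.snd.comp (Computable.snd.comp Computable.snd)
  have hstep : Computable₂ fun (σ : List Bool) (p : ℕ × ℕ × ℕ) =>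
      (Sum.casesOn (M.step p.2.1) (fun d => (d, p.2.2))
        fun d => (bif σ.getD p.2.2 false then d.2 else d.1, p.2.2 + 1) : ℕ × ℕ) := by
    refine Computable.sumCasesOn (f := fun q : List Bool × ℕ × ℕ × ℕ => M.step q.2.2.1)
      (M.computable_step.comp (Computable.fst.comp (Computable.snd.comp Computable.snd))) ?_ ?_
    · exact Computable.pair Computable.snd (hcnt.comp Computable.fst)
    · exact Computable.pair (Computable.cond hbit (Computable.snd.comp Computable.snd)
        (Computable.fst.comp Computable.snd)) (Computable.succ.comp (hcnt.comp Computable.fst))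
  have hrun := Computable.nat_rec (f := List.length) (g := fun _ : List Bool => (M.start, 0))
    Computable.list_length (Computable.const _) hstep
  refine (M.computable_out.comp (Computable.fst.comp hrun)).of_eq fun σ => ?_
  rw [outputAfter]
  congr 2
  induction σ.length with
  | zero => rfl
  | succ t ih =>
    simp only [run, ih]
    rcases M.step (M.run (fun j => σ.getD j false) t).1 with d | ⟨d₀, d₁⟩
    · rfl
    · simp [cond_eq_ite]

/-- For a decidable property `R` of finite bit sequences and numbers there is a probabilistic
machine which outputs those numbers that have the property together with some initial segment of
the random bits. -/
theorem exists_enumerated_eq {R : List Bool → ℕ → Prop} (hR : PrimrecRel R) :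
    ∃ P : ProbEnumMachine, ∀ w, P.enumerated w = {y | ∃ n, R (bitPrefix w n) y} := by
  classical
  let e : List Bool → ℕ := Encodable.encode
  let d : ℕ → List Bool := fun c => (Encodable.decode c).getD []
  have hd : Primrec d := Primrec.option_getD.comp Primrec.decode (Primrec.const [])
  have hde : ∀ σ, d (e σ) = σ := fun σ => by simp [d, e]
  have happ : ∀ b : Bool, Primrec fun c => e (d c ++ [b]) := fun b =>
    Primrec.encode.comp (Primrec.list_concat.comp hd (Primrec.const b))
  -- Dovetailing: at time `t = Nat.pair n y` the machine tests `R` on the first `n` bits and `y`.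
  -- Since `n ≤ t`, these bits have already been read.
  have hlen : Primrec fun c => (d c).length.unpair := Primrec.unpair.comp (Primrec.list_length.comp hd)
  let P : ProbEnumMachine :=
    { start := e []
      step := fun c => Sum.inr (e (d c ++ [false]), e (d c ++ [true]))
      out := fun c => if R ((d c).take (d c).length.unpair.1) (d c).length.unpair.2
        then some (d c).length.unpair.2 else none
      computable_step := (Primrec.sumInr.comp ((happ false).pair (happ true))).to_comp
      computable_out := by
        exact (Primrec.ite (hR.comp (Primrec.list_take.comp (Primrec.fst.comp hlen) hd)
          (Primrec.snd.comp hlen)) (Primrec.option_some.comp (Primrec.snd.comp hlen))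
          (Primrec.const none)).to_comp }
  have hrun : ∀ w t, P.run w t = (e (bitPrefix w t), t) := by
    intro w t
    induction t with
    | zero => rfl
    | succ t ih =>
      simp only [run, ih, P, hde, bitPrefix_succ]
      cases w t <;> simp
  refine ⟨P, fun w => ?_⟩
  ext y
  simp only [enumerated, Set.mem_ofPred_eq, hrun]
  simp only [P, hde, length_bitPrefix]
  constructor
  · rintro ⟨t, ht⟩
    rw [take_bitPrefix w (Nat.unpair_left_le t)] at ht
    by_cases h : R (bitPrefix w t.unpair.1) t.unpair.2
    · simp [h] at ht
      exact ⟨_, ht ▸ h⟩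
    · simp [h] at ht
  · rintro ⟨n, hn⟩
    refine ⟨n.pair y, ?_⟩
    rw [take_bitPrefix w (Nat.unpair_left_le _)]
    simp [hn]

end ProbEnumMachine

/-! ### Held-back outputs and stages -/

/-- All binary words of length `i`. -/
def words : ℕ → List (List Bool)
  | 0 => [[]]
  | i + 1 => (words i).flatMap fun σ => [σ ++ [false], σ ++ [true]]

/-- The numbers less than `n` that the approximation `a i` finds on the initial segments of `σ`. -/
def seenBelow (a : ℕ → List Bool → Option ℕ) (i n : ℕ) (σ : List Bool) : List ℕ :=
  (List.range n).filter fun y => y ∈ (List.range (i + 1)).filterMap fun t => a i (σ.take t)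

/-- The words `q` in a table `T` of words and finite sets, for which the set contains numbers less
than `n` only, and on which the same numbers less than `n` have been seen as on `σ`. -/
def tableGroup (a : ℕ → List Bool → Option ℕ) (T : List (List Bool × List ℕ)) (i n : ℕ)
    (σ : List Bool) : List (List Bool × List ℕ) :=
  T.filter fun q => (∀ y ∈ q.2, y < n) ∧ seenBelow a i n q.1 = seenBelow a i n σ

/-- The next set for the entry `p` of the table `T` for the words of length `i`. -/
def tableUpdate (a : ℕ → List Bool → Option ℕ) (h i : ℕ) (T : List (List Bool × List ℕ))
    (p : List Bool × List ℕ) : List ℕ :=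
  if (∀ y ∈ p.2, y < i.unpair.1) ∧ 2 ^ i ≤ 2 ^ (h + 1) * (tableGroup a T i i.unpair.1 p.1).length
  then seenBelow a i i.unpair.1 p.1 else p.2

/-- The table of the words of length `i` with the finite sets assigned to them: at the step from
`i` to `i + 1`, with `n = i.unpair.1`, the set assigned to `σ` is replaced by the set of numbers
less than `n` seen on `σ` if this replacement affects at least the fraction `2 ^ (-h - 1)` of all
words in the same way. -/
def table (a : ℕ → List Bool → Option ℕ) (h : ℕ) : ℕ → List (List Bool × List ℕ)
  | 0 => [([], [])]
  | i + 1 => (table a h i).flatMap fun p =>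
    [(p.1 ++ [false], tableUpdate a h i (table a h i) p),
      (p.1 ++ [true], tableUpdate a h i (table a h i) p)]

/-- At a time `u' ≤ u`, on an input of length at most `k`, exactly the elements of `b` are seen. -/
def MatchedBy (d : ℕ → List Bool × ℕ → Option ℕ) (k u : ℕ) (b : List ℕ) : Prop :=
  ∃ x ∈ (List.range (k + 1)).flatMap words, ∃ u' ∈ List.range (u + 1),
    (∀ y ∈ (List.range (u' + 1)).filterMap (fun t => d u' (x, t)), y ∈ b) ∧
      ∀ y ∈ b, y ∈ (List.range (u' + 1)).filterMap (fun t => d u' (x, t))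

open Classical in
/-- The stage reached at the time `u`: the stage `i` is left when all sets of the `i`-th table have
been matched. -/
noncomputable def stage (a : ℕ → List Bool → Option ℕ) (d : ℕ → List Bool × ℕ → Option ℕ)
    (h k : ℕ) : ℕ → ℕ
  | 0 => 0
  | u + 1 => if ∀ p ∈ table a h (stage a d h k u), MatchedBy d k u p.2
    then stage a d h k u + 1 else stage a d h k u

/-- The number with the binary expansion `q`. -/
def binaryValue (q : List Bool) : ℕ := q.foldl (fun n b => 2 * n + b.toNat) 0

/-- The number of leading ones of a word. -/
def leadingOnes (σ : List Bool) : ℕ := (σ.takeWhile id).length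

/-- The pair of parameters written in self-delimiting form at the beginning of `σ`. -/
def header (σ : List Bool) : ℕ × ℕ :=
  (binaryValue ((σ.drop (leadingOnes σ + 1)).take (leadingOnes σ))).unpair

/-- The rest of a word after the parameters. -/
def payload (σ : List Bool) : List Bool := (σ.drop (leadingOnes σ + 1)).drop (leadingOnes σ)

/-- The numbers assigned to the current prefix of `v` at the stage reached at the time `|v|`. -/
def Emits (a : ℕ → List Bool → Option ℕ) (d : ℕ → List Bool × ℕ → Option ℕ)
    (c : ℕ × ℕ) (v : List Bool) (y : ℕ) : Prop :=
  ∃ p ∈ table a c.1 (stage a d c.1 c.2 v.length),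
    p.1 = v.take (stage a d c.1 c.2 v.length) ∧ y ∈ p.2

/-! ### Primitive recursiveness of tables, stages and emission -/

section Primrec

variable {α β : Type*} [Primcodable α] [Primcodable β]

theorem PrimrecPred.forall_mem {R : α → β → Prop} (hR : PrimrecRel R) {L : α → List β}
    (hL : Primrec L) : PrimrecPred fun x => ∀ y ∈ L x, R x y :=
  (PrimrecRel.forall_mem_list (R := fun y x => R x y) hR.swap).comp hL Primrec.id

theorem PrimrecPred.exists_mem {R : α → β → Prop} (hR : PrimrecRel R) {L : α → List β}
    (hL : Primrec L) : PrimrecPred fun x => ∃ y ∈ L x, R x y :=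
  (PrimrecRel.exists_mem_list (R := fun y x => R x y) hR.swap).comp hL Primrec.id

theorem PrimrecPred.mem {f : α → β} {L : α → List β} (hf : Primrec f) (hL : Primrec L) :
    PrimrecPred fun x => f x ∈ L x :=
  (PrimrecPred.exists_mem (R := fun x y => y = f x)
    (Primrec.eq.comp Primrec.snd (hf.comp Primrec.fst)) hL).of_eq fun x => by simp

theorem Primrec.list_filter {R : α → β → Prop} [DecidableRel R] (hR : PrimrecRel R)
    {L : α → List β} (hL : Primrec L) : Primrec fun x => (L x).filter fun y => R x y :=
  (PrimrecRel.listFilter (R := fun y x => R x y) hR.swap).comp hL Primrec.id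

theorem Primrec.nat_two_pow : Primrec fun n : ℕ => 2 ^ n := by
  refine (Primrec.nat_rec₁ (f := fun _ m => 2 * m) 1
    (Primrec.nat_double.comp Primrec.snd)).of_eq fun n => ?_
  induction n with
  | zero => rfl
  | succ n ih => simp only [ih, pow_succ]; ring

theorem primrec_words : Primrec words := by
  have h : Primrec₂ fun (_ : ℕ) (W : List (List Bool)) =>
      W.flatMap fun σ => [σ ++ [false], σ ++ [true]] := by
    refine Primrec.list_flatMap (f := fun p : ℕ × List (List Bool) => p.2)
      (g := fun _ σ => [σ ++ [false], σ ++ [true]]) Primrec.snd ?_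
    exact Primrec.list_cons.comp (Primrec.list_concat.comp Primrec.snd (Primrec.const false))
      (Primrec.list_cons.comp (Primrec.list_concat.comp Primrec.snd (Primrec.const true))
        (Primrec.const []))
  refine (Primrec.nat_rec₁ [[]] h).of_eq fun n => ?_
  induction n with
  | zero => rfl
  | succ n ih => simp only [ih, words]

variable {a : ℕ → List Bool → Option ℕ} {d : ℕ → List Bool × ℕ → Option ℕ}

theorem primrec_seenBelow (ha : Primrec₂ a) {i n : α → ℕ} {σ : α → List Bool}
    (hi : Primrec i) (hn : Primrec n) (hσ : Primrec σ) :
    Primrec fun x => seenBelow a (i x) (n x) (σ x) := by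
  have hlist : Primrec fun x : α =>
      (List.range (i x + 1)).filterMap fun t => a (i x) ((σ x).take t) := by
    refine Primrec.listFilterMap (Primrec.list_range.comp (Primrec.succ.comp hi)) ?_
    exact ha.comp (hi.comp Primrec.fst)
      (Primrec.list_take.comp Primrec.snd (hσ.comp Primrec.fst))
  exact Primrec.list_filter (R := fun x y =>
      y ∈ (List.range (i x + 1)).filterMap fun t => a (i x) ((σ x).take t))
    (PrimrecPred.mem Primrec.snd (hlist.comp Primrec.fst)) (Primrec.list_range.comp hn)

theorem primrecPred_forall_lt {L : α → List ℕ} {n : α → ℕ} (hL : Primrec L) (hn : Primrec n) :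
    PrimrecPred fun x => ∀ y ∈ L x, y < n x :=
  PrimrecPred.forall_mem (R := fun x y => y < n x)
    (Primrec.nat_lt.comp Primrec.snd (hn.comp Primrec.fst)) hL

theorem primrec_tableGroup (ha : Primrec₂ a) {T : α → List (List Bool × List ℕ)}
    {i n : α → ℕ} {σ : α → List Bool} (hT : Primrec T) (hi : Primrec i) (hn : Primrec n)
    (hσ : Primrec σ) : Primrec fun x => tableGroup a (T x) (i x) (n x) (σ x) := by
  have hb : PrimrecPred fun p : α × List Bool × List ℕ => ∀ y ∈ p.2.2, y < n p.1 :=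
    primrecPred_forall_lt (Primrec.snd.comp Primrec.snd) (hn.comp Primrec.fst)
  have he : PrimrecPred fun p : α × List Bool × List ℕ =>
      seenBelow a (i p.1) (n p.1) p.2.1 = seenBelow a (i p.1) (n p.1) (σ p.1) :=
    Primrec.eq.comp
      (primrec_seenBelow ha (hi.comp Primrec.fst) (hn.comp Primrec.fst)
        (Primrec.fst.comp Primrec.snd))
      (primrec_seenBelow ha (hi.comp Primrec.fst) (hn.comp Primrec.fst) (hσ.comp Primrec.fst))
  exact Primrec.list_filter (R := fun x (q : List Bool × List ℕ) =>
    (∀ y ∈ q.2, y < n x) ∧ seenBelow a (i x) (n x) q.1 = seenBelow a (i x) (n x) (σ x))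
    (hb.and he) hT

theorem primrec_tableUpdate (ha : Primrec₂ a) {h i : α → ℕ} {T : α → List (List Bool × List ℕ)}
    {p : α → List Bool × List ℕ} (hh : Primrec h) (hi : Primrec i) (hT : Primrec T)
    (hp : Primrec p) : Primrec fun x => tableUpdate a (h x) (i x) (T x) (p x) := by
  have hn : Primrec fun x => (i x).unpair.1 := Primrec.fst.comp (Primrec.unpair.comp hi)
  have hp1 := Primrec.fst.comp hp
  have hp2 := Primrec.snd.comp hp
  have hlen := Primrec.list_length.comp (primrec_tableGroup ha hT hi hn hp1)
  exact Primrec.ite ((primrecPred_forall_lt hp2 hn).and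
    (Primrec.nat_le.comp (Primrec.nat_two_pow.comp hi) (Primrec.nat_mul.comp
      (Primrec.nat_two_pow.comp (Primrec.succ.comp hh)) hlen)))
    (primrec_seenBelow ha hi hn hp1) hp2

theorem primrec_table (ha : Primrec₂ a) : Primrec₂ (table a) := by
  have hstep : Primrec₂ fun (h : ℕ) (q : ℕ × List (List Bool × List ℕ)) =>
      q.2.flatMap fun p => [(p.1 ++ [false], tableUpdate a h q.1 q.2 p),
        (p.1 ++ [true], tableUpdate a h q.1 q.2 p)] := by
    refine Primrec.list_flatMap
      (f := fun x : ℕ × ℕ × List (List Bool × List ℕ) => x.2.2)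
      (g := fun x p => [(p.1 ++ [false], tableUpdate a x.1 x.2.1 x.2.2 p),
        (p.1 ++ [true], tableUpdate a x.1 x.2.1 x.2.2 p)]) (Primrec.snd.comp Primrec.snd) ?_
    have hu : Primrec fun z : (ℕ × ℕ × List (List Bool × List ℕ)) × List Bool × List ℕ =>
        tableUpdate a z.1.1 z.1.2.1 z.1.2.2 z.2 :=
      primrec_tableUpdate ha (Primrec.fst.comp Primrec.fst)
        (Primrec.fst.comp (Primrec.snd.comp Primrec.fst))
        (Primrec.snd.comp (Primrec.snd.comp Primrec.fst)) Primrec.snd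
    have hc : ∀ b : Bool,
        Primrec fun z : (ℕ × ℕ × List (List Bool × List ℕ)) × List Bool × List ℕ =>
          (z.2.1 ++ [b], tableUpdate a z.1.1 z.1.2.1 z.1.2.2 z.2) := fun b =>
      (Primrec.list_concat.comp (Primrec.fst.comp Primrec.snd) (Primrec.const b)).pair hu
    exact Primrec.list_cons.comp (hc false)
      (Primrec.list_cons.comp (hc true) (Primrec.const []))
  refine (Primrec.nat_rec (f := fun _ : ℕ => [(([] : List Bool), ([] : List ℕ))])
    (Primrec.const _) hstep).of_eq ?_
  intro h i
  induction i with
  | zero => rfl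
  | succ i ih => simp only [table] at ih ⊢; rw [ih]

theorem primrecPred_matchedBy (hd : Primrec₂ d) {k u : α → ℕ} {b : α → List ℕ}
    (hk : Primrec k) (hu : Primrec u) (hb : Primrec b) :
    PrimrecPred fun x => MatchedBy d (k x) (u x) (b x) := by
  have hL : Primrec fun z : (α × List Bool) × ℕ =>
      (List.range (z.2 + 1)).filterMap fun t => d z.2 (z.1.2, t) := by
    refine Primrec.listFilterMap (Primrec.list_range.comp (Primrec.succ.comp Primrec.snd)) ?_
    exact hd.comp (Primrec.snd.comp Primrec.fst)
      ((Primrec.snd.comp (Primrec.fst.comp Primrec.fst)).pair Primrec.snd)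
  have hbz : Primrec fun z : (α × List Bool) × ℕ => b z.1.1 :=
    hb.comp (Primrec.fst.comp Primrec.fst)
  have h1 := PrimrecPred.forall_mem (R := fun (z : (α × List Bool) × ℕ) y => y ∈ b z.1.1)
    (PrimrecPred.mem Primrec.snd (hbz.comp Primrec.fst)) hL
  have h2 := PrimrecPred.forall_mem (R := fun (z : (α × List Bool) × ℕ) y =>
    y ∈ (List.range (z.2 + 1)).filterMap fun t => d z.2 (z.1.2, t))
    (PrimrecPred.mem Primrec.snd (hL.comp Primrec.fst)) hbz
  have h3 := PrimrecPred.exists_mem (R := fun (z : α × List Bool) (u' : ℕ) =>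
    (∀ y ∈ (List.range (u' + 1)).filterMap (fun t => d u' (z.2, t)), y ∈ b z.1) ∧
      ∀ y ∈ b z.1, y ∈ (List.range (u' + 1)).filterMap (fun t => d u' (z.2, t))) (h1.and h2)
    (Primrec.list_range.comp (Primrec.succ.comp (hu.comp Primrec.fst)))
  exact PrimrecPred.exists_mem h3.primrecRel (Primrec.list_flatMap
    (Primrec.list_range.comp (Primrec.succ.comp hk)) (primrec_words.comp Primrec.snd))

theorem primrec_stage (ha : Primrec₂ a) (hd : Primrec₂ d) {c : α → ℕ × ℕ} {u : α → ℕ}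
    (hc : Primrec c) (hu : Primrec u) : Primrec fun x => stage a d (c x).1 (c x).2 (u x) := by
  classical
  have hcond : PrimrecPred fun z : (ℕ × ℕ) × ℕ × ℕ =>
      ∀ p ∈ table a z.1.1 z.2.2, MatchedBy d z.1.2 z.2.1 p.2 :=
    PrimrecPred.forall_mem (R := fun (z : (ℕ × ℕ) × ℕ × ℕ) (p : List Bool × List ℕ) =>
        MatchedBy d z.1.2 z.2.1 p.2)
      (primrecPred_matchedBy hd (Primrec.snd.comp (Primrec.fst.comp Primrec.fst))
        (Primrec.fst.comp (Primrec.snd.comp Primrec.fst)) (Primrec.snd.comp Primrec.snd))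
      ((primrec_table ha).comp (Primrec.fst.comp Primrec.fst) (Primrec.snd.comp Primrec.snd))
  have hstep : Primrec₂ fun (c : ℕ × ℕ) (q : ℕ × ℕ) =>
      if ∀ p ∈ table a c.1 q.2, MatchedBy d c.2 q.1 p.2 then q.2 + 1 else q.2 :=
    Primrec.ite hcond (Primrec.succ.comp (Primrec.snd.comp Primrec.snd))
      (Primrec.snd.comp Primrec.snd)
  have hrec : Primrec₂ fun (c : ℕ × ℕ) (u : ℕ) => stage a d c.1 c.2 u := by
    refine (Primrec.nat_rec (f := fun _ : ℕ × ℕ => 0) (Primrec.const 0) hstep).of_eq ?_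
    intro c u
    induction u with
    | zero => rfl
    | succ u ih => simp only [stage] at ih ⊢; rw [ih]
  exact hrec.comp hc hu

theorem primrec_binaryValue : Primrec binaryValue := by
  refine Primrec.list_foldl (h := fun _ (p : ℕ × Bool) => 2 * p.1 + p.2.toNat) Primrec.id
    (Primrec.const 0) ?_
  exact Primrec.nat_add.comp (Primrec.nat_double.comp (Primrec.fst.comp Primrec.snd))
    ((Primrec.dom_bool Bool.toNat).comp (Primrec.snd.comp Primrec.snd))

theorem primrec_leadingOnes : Primrec leadingOnes :=
  Primrec.list_length.comp (Primrec.list_takeWhile Primrec.id)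

theorem primrec_drop_leadingOnes :
    Primrec fun σ : List Bool => σ.drop (leadingOnes σ + 1) :=
  Primrec.list_drop.comp (Primrec.succ.comp primrec_leadingOnes) Primrec.id

theorem primrec_header : Primrec header :=
  Primrec.unpair.comp (primrec_binaryValue.comp
    (Primrec.list_take.comp primrec_leadingOnes primrec_drop_leadingOnes))

theorem primrec_payload : Primrec payload :=
  Primrec.list_drop.comp primrec_leadingOnes primrec_drop_leadingOnes

theorem primrecRel_emits (ha : Primrec₂ a) (hd : Primrec₂ d) :
    PrimrecRel fun σ y => Emits a d (header σ) (payload σ) y := by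
  have hs : Primrec fun σ : List Bool =>
      stage a d (header σ).1 (header σ).2 (payload σ).length :=
    primrec_stage ha hd primrec_header (Primrec.list_length.comp primrec_payload)
  have hpre : PrimrecPred fun z : (List Bool × ℕ) × List Bool × List ℕ => z.2.1 =
      (payload z.1.1).take (stage a d (header z.1.1).1 (header z.1.1).2 (payload z.1.1).length) :=
    Primrec.eq.comp (Primrec.fst.comp Primrec.snd)
      ((Primrec.list_take.comp hs primrec_payload).comp (Primrec.fst.comp Primrec.fst))
  have hmem : PrimrecPred fun z : (List Bool × ℕ) × List Bool × List ℕ => z.1.2 ∈ z.2.2 :=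
    PrimrecPred.mem (Primrec.snd.comp Primrec.fst) (Primrec.snd.comp Primrec.snd)
  exact PrimrecPred.exists_mem (R := fun (z : List Bool × ℕ) (p : List Bool × List ℕ) =>
      p.1 = (payload z.1).take
        (stage a d (header z.1).1 (header z.1).2 (payload z.1).length) ∧ z.2 ∈ p.2)
    (hpre.and hmem) (((primrec_table ha).comp (Primrec.fst.comp primrec_header) hs).comp
      Primrec.fst)

end Primrec

/-! ### The uniform measure of cylinder sets -/

instance : IsProbabilityMeasure coinMeasure := by
  unfold coinMeasure; infer_instance

theorem bitPrefix_eq_iff {v w : ℕ → Bool} {n : ℕ} :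
    bitPrefix v n = bitPrefix w n ↔ ∀ j < n, v j = w j := by
  simp [bitPrefix]

theorem exists_bitPrefix_eq (σ : List Bool) : ∃ w, bitPrefix w σ.length = σ := by
  refine ⟨fun j => σ.getD j false, List.ext_getElem (by simp) fun j h₁ h₂ => ?_⟩
  simp [bitPrefix, h₂]

theorem coinMeasure_bitPrefix_eq (σ : List Bool) {n : ℕ} (hn : σ.length = n) :
    coinMeasure {w | bitPrefix w n = σ} = 2⁻¹ ^ n := by
  obtain ⟨v, hv⟩ := exists_bitPrefix_eq σ
  rw [hn] at hv
  have h : {w | bitPrefix w n = σ} = Set.pi (Finset.range n) fun j => {v j} := by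
    ext w
    rw [← hv, Set.mem_ofPred_eq, bitPrefix_eq_iff]
    simp
  rw [h, coinMeasure, Measure.infinitePi_pi]
  · simp
  · simp

theorem coinMeasure_bitPrefix_mem_le (L : List (List Bool)) {n : ℕ} (hL : ∀ σ ∈ L, σ.length = n) :
    coinMeasure {w | bitPrefix w n ∈ L} ≤ L.length * 2⁻¹ ^ n := by
  induction L with
  | nil => simp
  | cons σ L ih =>
    have h : {w | bitPrefix w n ∈ σ :: L} =
        {w | bitPrefix w n = σ} ∪ {w | bitPrefix w n ∈ L} := by
      ext w; simp
    rw [h, List.length_cons]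
    refine (measure_union_le _ _).trans ?_
    rw [coinMeasure_bitPrefix_eq σ (hL σ (by simp))]
    calc _ ≤ (2⁻¹ : ℝ≥0∞) ^ n + L.length * 2⁻¹ ^ n :=
          add_le_add le_rfl (ih fun τ hτ => hL τ (by simp [hτ]))
      _ = _ := by push_cast; ring

theorem measurable_bitPrefix (n : ℕ) : @Measurable _ (List Bool) _ ⊤ fun w => bitPrefix w n := by
  have h : (fun w : ℕ → Bool => bitPrefix w n) =
      (fun v : Fin n → Bool => List.ofFn v) ∘ fun w j => w j := by
    funext w
    refine List.ext_getElem (by simp) fun j h₁ h₂ => ?_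
    simp [bitPrefix]
  rw [h]
  exact Measurable.comp (@measurable_of_countable _ _ _ ⊤ _ _ _)
    (measurable_pi_lambda _ fun j => measurable_pi_apply _)

/-- Distinct words of the same length give disjoint cylinders, so the union bound becomes an
equality. -/
theorem coinMeasure_bitPrefix_mem {L : List (List Bool)} (hnd : L.Nodup) {n : ℕ}
    (hL : ∀ σ ∈ L, σ.length = n) :
    coinMeasure {w | bitPrefix w n ∈ L} = L.length * 2⁻¹ ^ n := by
  induction L with
  | nil => simp
  | cons σ L ih =>
    have h : {w | bitPrefix w n ∈ σ :: L} =
        {w | bitPrefix w n ∈ L} ∪ {w | bitPrefix w n = σ} := by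
      ext w; simp [or_comm]
    have hd : Disjoint {w | bitPrefix w n ∈ L} {w | bitPrefix w n = σ} := by
      rw [Set.disjoint_left]
      rintro w hw rfl
      exact (List.nodup_cons.1 hnd).1 hw
    rw [h, List.length_cons, measure_union hd ((measurable_bitPrefix n) (t := {σ}) trivial),
      coinMeasure_bitPrefix_eq σ (hL σ (by simp)),
      ih (List.nodup_cons.1 hnd).2 fun τ hτ => hL τ (by simp [hτ])]
    push_cast
    ring

/-! ### Properties of the held-back outputs -/

/-- The finite set which the `i`-th table assigns to the first `i` bits of `w`. -/
def held (a : ℕ → List Bool → Option ℕ) (h : ℕ) (w : ℕ → Bool) : ℕ → List ℕ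
  | 0 => []
  | i + 1 => tableUpdate a h i (table a h i) (bitPrefix w i, held a h w i)

section Held

variable {a : ℕ → List Bool → Option ℕ} {h : ℕ}

theorem mem_words {i : ℕ} {σ : List Bool} : σ ∈ words i ↔ σ.length = i := by
  induction i generalizing σ with
  | zero => simp [words]
  | succ i ih =>
    simp only [words, List.mem_flatMap, ih]
    constructor
    · rintro ⟨τ, rfl, hτ⟩
      simp at hτ
      rcases hτ with rfl | rfl <;> simp
    · intro hσ
      have hne : σ ≠ [] := by rintro rfl; simp at hσ
      refine ⟨σ.dropLast, by simp [hσ], ?_⟩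
      rw [← List.dropLast_append_getLast hne]
      cases σ.getLast hne <;> simp

theorem nodup_words (i : ℕ) : (words i).Nodup := by
  induction i with
  | zero => simp [words]
  | succ i ih =>
    rw [words, List.nodup_flatMap]
    refine ⟨fun σ _ => by simp, ih.imp fun {σ τ} hne => ?_⟩
    intro x hx hy
    simp at hx hy
    rcases hx with rfl | rfl <;> rcases hy with hy | hy <;>
      simp at hy <;> exact hne hy

theorem map_fst_table (i : ℕ) : (table a h i).map Prod.fst = words i := by
  induction i with
  | zero => rfl
  | succ i ih =>
    rw [table, words, ← ih, List.map_flatMap, List.flatMap_map]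
    rfl

theorem held_congr {v w : ℕ → Bool} {i : ℕ} (hvw : bitPrefix v i = bitPrefix w i) :
    held a h v i = held a h w i := by
  induction i with
  | zero => rfl
  | succ i ih =>
    have h' : bitPrefix v i = bitPrefix w i := by
      have := congrArg (List.take i) hvw
      rwa [take_bitPrefix _ i.le_succ, take_bitPrefix _ i.le_succ] at this
    simp only [held, h', ih h']

/-- Passes from the computed list to functions of the random bits, on which the measure arguments
operate. -/
theorem mem_table_iff {i : ℕ} {p : List Bool × List ℕ} :
    p ∈ table a h i ↔ ∃ w, (bitPrefix w i, held a h w i) = p := by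
  induction i generalizing p with
  | zero => simp [table, held, bitPrefix, eq_comm]
  | succ i ih =>
    simp only [table, List.mem_flatMap, ih]
    constructor
    · rintro ⟨_, ⟨w, rfl⟩, hp⟩
      have key : ∀ b : Bool, ∃ v, (bitPrefix v (i + 1), held a h v (i + 1)) =
          (bitPrefix w i ++ [b],
            tableUpdate a h i (table a h i) (bitPrefix w i, held a h w i)) := by
        intro b
        obtain ⟨v, hv⟩ := exists_bitPrefix_eq (bitPrefix w i ++ [b])
        simp only [List.length_append, length_bitPrefix, List.length_singleton] at hv
        have hvi : bitPrefix v i = bitPrefix w i := by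
          have := congrArg (List.take i) hv
          rw [take_bitPrefix _ i.le_succ] at this
          simpa using this
        exact ⟨v, by rw [hv, held, hvi, held_congr hvi]⟩
      simp at hp
      rcases hp with rfl | rfl
      exacts [key false, key true]
    · rintro ⟨w, rfl⟩
      refine ⟨_, ⟨w, rfl⟩, ?_⟩
      rw [bitPrefix_succ, held]
      cases w i <;> simp

theorem mem_seenBelow {i n y : ℕ} {w : ℕ → Bool} :
    y ∈ seenBelow a i n (bitPrefix w i) ↔ y < n ∧ ∃ t ≤ i, a i (bitPrefix w t) = some y := by
  simp only [seenBelow, List.mem_filter, List.mem_range, List.mem_filterMap, decide_eq_true_eq,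
    Nat.lt_succ_iff]
  refine and_congr_right fun _ => exists_congr fun t => and_congr_right fun ht => ?_
  rw [take_bitPrefix w ht]

/-- The entry for `w` is replaced at the step from `i` to `i + 1`. -/
def IsUpdated (a : ℕ → List Bool → Option ℕ) (h : ℕ) (w : ℕ → Bool) (i : ℕ) : Prop :=
  (∀ y ∈ held a h w i, y < i.unpair.1) ∧
    2 ^ i ≤ 2 ^ (h + 1) *
      (tableGroup a (table a h i) i i.unpair.1 (bitPrefix w i)).length

theorem held_succ_of_isUpdated {w : ℕ → Bool} {i : ℕ} (hu : IsUpdated a h w i) :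
    held a h w (i + 1) = seenBelow a i i.unpair.1 (bitPrefix w i) := by
  rw [held, tableUpdate]
  exact if_pos hu

theorem held_succ_of_not_isUpdated {w : ℕ → Bool} {i : ℕ} (hu : ¬ IsUpdated a h w i) :
    held a h w (i + 1) = held a h w i := by
  rw [held, tableUpdate]
  exact if_neg hu

/-- Approximations of the outputs on finite bit sequences grow. -/
def IsMonotoneApprox {α : Type*} (a : ℕ → α → Option ℕ) : Prop :=
  ∀ i j z y, i ≤ j → a i z = some y → a j z = some y

theorem exists_seen_of_mem_held (ha : IsMonotoneApprox a) {w : ℕ → Bool} {i y : ℕ}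
    (hy : y ∈ held a h w i) : ∃ t ≤ i, a i (bitPrefix w t) = some y := by
  induction i with
  | zero => simp [held] at hy
  | succ i ih =>
    have key : ∃ t ≤ i, a i (bitPrefix w t) = some y := by
      by_cases hu : IsUpdated a h w i
      · rw [held_succ_of_isUpdated hu] at hy
        exact (mem_seenBelow.1 hy).2
      · rw [held_succ_of_not_isUpdated hu] at hy
        exact ih hy
    obtain ⟨t, ht, h⟩ := key
    exact ⟨t, by omega, ha _ _ _ _ i.le_succ h⟩

/-- The clause in the update rule that all held numbers lie below `n` is what keeps a replacement
from losing any of them. -/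
theorem held_subset_succ (ha : IsMonotoneApprox a) (w : ℕ → Bool) (i : ℕ) :
    held a h w i ⊆ held a h w (i + 1) := by
  by_cases hu : IsUpdated a h w i
  · rw [held_succ_of_isUpdated hu]
    intro y hy
    exact mem_seenBelow.2 ⟨hu.1 y hy, exists_seen_of_mem_held ha hy⟩
  · rw [held_succ_of_not_isUpdated hu]
    exact List.Subset.refl _

theorem held_subset (ha : IsMonotoneApprox a) (w : ℕ → Bool) {i j : ℕ} (hij : i ≤ j) :
    held a h w i ⊆ held a h w j := by
  induction j, hij using Nat.le_induction with
  | base => exact List.Subset.refl _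
  | succ j _ ih => exact fun y hy => held_subset_succ ha w j (ih hy)

theorem mem_tableGroup {i n : ℕ} {w : ℕ → Bool} {σ : List Bool} :
    bitPrefix w i ∈ (tableGroup a (table a h i) i n σ).map Prod.fst ↔
      (∀ y ∈ held a h w i, y < n) ∧ seenBelow a i n (bitPrefix w i) = seenBelow a i n σ := by
  simp only [tableGroup, List.mem_map, List.mem_filter, decide_eq_true_eq, mem_table_iff]
  constructor
  · rintro ⟨_, ⟨⟨v, rfl⟩, h1, h2⟩, h3⟩
    simp only at h1 h2 h3
    rw [held_congr h3] at h1
    rw [h3] at h2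
    exact ⟨h1, h2⟩
  · rintro ⟨h1, h2⟩
    exact ⟨_, ⟨⟨w, rfl⟩, h1, h2⟩, rfl⟩

theorem nodup_map_fst_tableGroup (i n : ℕ) (σ : List Bool) :
    ((tableGroup a (table a h i) i n σ).map Prod.fst).Nodup := by
  refine List.Nodup.sublist (List.Sublist.map _ List.filter_sublist) ?_
  rw [map_fst_table]
  exact nodup_words i

theorem length_of_mem_tableGroup {i n : ℕ} {σ τ : List Bool}
    (hτ : τ ∈ (tableGroup a (table a h i) i n σ).map Prod.fst) : τ.length = i := by
  have : τ ∈ (table a h i).map Prod.fst :=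
    (List.Sublist.map _ List.filter_sublist).subset hτ
  rwa [map_fst_table, mem_words] at this

/-- The set of words that get the same new set as `w` contains a large fraction of all words. -/
theorem exists_words_of_isUpdated {w : ℕ → Bool} {i : ℕ} (hu : IsUpdated a h w i) :
    ∃ L : List (List Bool), L.Nodup ∧ (∀ σ ∈ L, σ.length = i) ∧ 2 ^ i ≤ 2 ^ (h + 1) * L.length ∧
      ∀ v, bitPrefix v i ∈ L → held a h v (i + 1) = held a h w (i + 1) := by
  refine ⟨(tableGroup a (table a h i) i i.unpair.1 (bitPrefix w i)).map Prod.fst,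
    nodup_map_fst_tableGroup _ _ _, fun σ => length_of_mem_tableGroup, by simpa using hu.2, ?_⟩
  intro v hv
  obtain ⟨h1, h2⟩ := mem_tableGroup.1 hv
  -- The group depends on the word only through what is seen on it, so `v` and `w` have the same
  -- group.
  have hv : IsUpdated a h v i := ⟨h1, by simpa only [tableGroup, h2] using hu.2⟩
  rw [held_succ_of_isUpdated hv, held_succ_of_isUpdated hu, h2]

/-- If the words on which an update to the same set is possible have large measure, then the update
takes place. -/
theorem isUpdated_of_lt_coinMeasure {w : ℕ → Bool} {i : ℕ} {A : Set (ℕ → Bool)}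
    (hA : (2⁻¹ : ℝ≥0∞) ^ (h + 1) < coinMeasure A) (hwA : w ∈ A)
    (hheld : ∀ v ∈ A, ∀ y ∈ held a h v i, y < i.unpair.1)
    (hseen : ∀ v ∈ A, seenBelow a i i.unpair.1 (bitPrefix v i) =
      seenBelow a i i.unpair.1 (bitPrefix w i)) : IsUpdated a h w i := by
  refine ⟨hheld w hwA, ?_⟩
  set G := tableGroup a (table a h i) i i.unpair.1 (bitPrefix w i) with hG
  have h1 : A ⊆ {v | bitPrefix v i ∈ G.map Prod.fst} := fun v hv =>
    mem_tableGroup.2 ⟨hheld v hv, hseen v hv⟩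
  have h2 := hA.trans_le ((measure_mono h1).trans
    (coinMeasure_bitPrefix_mem_le _ fun σ => length_of_mem_tableGroup))
  rw [List.length_map] at h2
  have h3 : (2⁻¹ : ℝ≥0∞) ^ (h + 1) * 2 ^ (h + 1) = 1 := by
    rw [← mul_pow, ENNReal.inv_mul_cancel (by simp) (by simp), one_pow]
  have h4 : (2⁻¹ : ℝ≥0∞) ^ i * 2 ^ i = 1 := by
    rw [← mul_pow, ENNReal.inv_mul_cancel (by simp) (by simp), one_pow]
  have h5 : ((2 ^ i : ℕ) : ℝ≥0∞) ≤ ((2 ^ (h + 1) * G.length : ℕ) : ℝ≥0∞) := by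
    push_cast
    calc (2 : ℝ≥0∞) ^ i = 2⁻¹ ^ (h + 1) * (2 ^ (h + 1) * 2 ^ i) := by
          rw [← mul_assoc, h3, one_mul]
      _ ≤ (G.length * 2⁻¹ ^ i) * (2 ^ (h + 1) * 2 ^ i) := mul_le_mul_left h2.le _
      _ = 2 ^ (h + 1) * G.length * (2⁻¹ ^ i * 2 ^ i) := by ring
      _ = _ := by rw [h4, mul_one]
  exact_mod_cast h5

end Held

/-! ### Infinite sets: unbounded held-back outputs and matching inputs -/

section Limit

variable {a : ℕ → List Bool → Option ℕ} {h : ℕ}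

/-- The numbers seen eventually with the random bits `w`. -/
def seenSet (a : ℕ → List Bool → Option ℕ) (w : ℕ → Bool) : Set ℕ :=
  {y | ∃ i t, a i (bitPrefix w t) = some y}

theorem held_subset_seenSet (ha : IsMonotoneApprox a) {w : ℕ → Bool} {i y : ℕ}
    (hy : y ∈ held a h w i) : y ∈ seenSet a w := by
  obtain ⟨t, _, ht⟩ := exists_seen_of_mem_held ha hy
  exact ⟨i, t, ht⟩

theorem eventually_mem_seenBelow (ha : IsMonotoneApprox a) {w : ℕ → Bool} {y : ℕ}
    (hy : y ∈ seenSet a w) : ∃ j, ∀ i ≥ j, ∀ n > y, y ∈ seenBelow a i n (bitPrefix w i) := by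
  obtain ⟨i, t, hit⟩ := hy
  refine ⟨max i t, fun i' hi' n hn => mem_seenBelow.2 ⟨hn, t, by omega, ?_⟩⟩
  exact ha _ _ _ _ (by omega) hit

theorem seenBelow_eq_of_forall {i n : ℕ} {w : ℕ → Bool}
    (hw : ∀ y < n, y ∈ seenSet a w → y ∈ seenBelow a i n (bitPrefix w i)) :
    ∀ y, y ∈ seenBelow a i n (bitPrefix w i) ↔ y < n ∧ y ∈ seenSet a w := by
  intro y
  constructor
  · intro hy
    obtain ⟨h1, t, _, ht⟩ := mem_seenBelow.1 hy
    exact ⟨h1, i, t, ht⟩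
  · rintro ⟨h1, h2⟩
    exact hw y h1 h2

/-- Both lists filter the same `List.range n`, so equal membership forces equal order and
multiplicity. -/
theorem seenBelow_ext {i n : ℕ} {σ τ : List Bool}
    (hst : ∀ y, y ∈ seenBelow a i n σ ↔ y ∈ seenBelow a i n τ) :
    seenBelow a i n σ = seenBelow a i n τ := by
  simp only [seenBelow] at hst ⊢
  refine List.filter_congr fun y hy => ?_
  have := hst y
  simp only [List.mem_filter, hy, true_and, decide_eq_true_eq] at this
  simp only [this]

/-- Continuity from below: a bound depending on the random bits becomes uniform on a subset whose
measure still exceeds `r`. The strict inequality survives repeated use. -/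
theorem exists_lt_measure_of_iUnion {A : Set (ℕ → Bool)} {B : ℕ → Set (ℕ → Bool)}
    (hB : Monotone B) (hAB : A ⊆ ⋃ m, B m) {r : ℝ≥0∞} (hr : r < coinMeasure A) :
    ∃ m, r < coinMeasure (B m) := by
  have := hr.trans_le (measure_mono hAB)
  rw [hB.measure_iUnion] at this
  exact lt_iSup_iff.1 this

/-- If an infinite set is enumerated with a large probability, then for some random bits which
enumerate it the held-back output is unbounded. -/
theorem exists_held_unbounded (ha : IsMonotoneApprox a) {S : Set ℕ} (hS : S.Infinite)
    (hp : (2⁻¹ : ℝ≥0∞) ^ (h + 1) < coinMeasure {w | seenSet a w = S}) :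
    ∃ w, seenSet a w = S ∧ ∀ N, ∃ i, ∃ y ∈ held a h w i, N ≤ y := by
  by_contra! hcon
  -- First a uniform bound `m` on everything held, then a uniform time `j` after which all elements
  -- of `S` up to some `z > m` are seen.
  obtain ⟨m, hm⟩ := exists_lt_measure_of_iUnion
    (B := fun m => {w | seenSet a w = S ∧ ∀ i, ∀ y ∈ held a h w i, y < m})
    (fun m m' hmm w hw => ⟨hw.1, fun i y hy => (hw.2 i y hy).trans_le hmm⟩)
    (fun w hw => by
      obtain ⟨N, hN⟩ := hcon w hw
      exact Set.mem_iUnion.2 ⟨N, hw, hN⟩) hp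
  obtain ⟨z, hzS, hz⟩ := hS.exists_gt m
  obtain ⟨j, hj⟩ := exists_lt_measure_of_iUnion
    (B := fun j => {w | (seenSet a w = S ∧ ∀ i, ∀ y ∈ held a h w i, y < m) ∧
      ∀ i ≥ j, ∀ y < z + 1, y ∈ seenSet a w → y ∈ seenBelow a i (z + 1) (bitPrefix w i)})
    (fun j j' hjj w hw => ⟨hw.1, fun i hi => hw.2 i (hjj.trans hi)⟩)
    (fun w hw => by
      have : ∀ y, ∃ j, ∀ i ≥ j, y < z + 1 → y ∈ seenSet a w →
          y ∈ seenBelow a i (z + 1) (bitPrefix w i) := by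
        intro y
        by_cases hy : y ∈ seenSet a w
        · obtain ⟨j, hj⟩ := eventually_mem_seenBelow ha hy
          exact ⟨j, fun i hi hyz _ => hj i hi _ hyz⟩
        · exact ⟨0, fun _ _ _ h => absurd h hy⟩
      choose j hj using this
      refine Set.mem_iUnion.2 ⟨(Finset.range (z + 1)).sup j, hw, fun i hi y hy hyw => ?_⟩
      exact hj y i ((Finset.le_sup (Finset.mem_range.2 hy)).trans hi) hy hyw) hm
  set A := {w | (seenSet a w = S ∧ ∀ i, ∀ y ∈ held a h w i, y < m) ∧
      ∀ i ≥ j, ∀ y < z + 1, y ∈ seenSet a w → y ∈ seenBelow a i (z + 1) (bitPrefix w i)} with hA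
  obtain ⟨w, hw⟩ : A.Nonempty := by
    by_contra hne
    rw [Set.not_nonempty_iff_eq_empty] at hne
    simp [hne] at hj
  -- The step `Nat.pair (z + 1) j` is late enough and uses the cutoff `z + 1`, so all of `A` is
  -- updated to the same set; that set contains `z`, against the bound `m`.
  have hi : j ≤ (Nat.pair (z + 1) j) := Nat.right_le_pair _ _
  have hn : (Nat.pair (z + 1) j).unpair.1 = z + 1 := by simp
  have hseen : ∀ v ∈ A, ∀ y, y ∈ seenBelow a (Nat.pair (z + 1) j) (z + 1)
      (bitPrefix v (Nat.pair (z + 1) j)) ↔ y < z + 1 ∧ y ∈ S := by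
    intro v hv y
    rw [seenBelow_eq_of_forall (hv.2 _ hi), hv.1.1]
  have hu : IsUpdated a h w (Nat.pair (z + 1) j) := by
    refine isUpdated_of_lt_coinMeasure hj hw (fun v hv y hy => ?_) (fun v hv => ?_)
    · have := hv.1.2 _ y hy
      omega
    · rw [hn]
      exact seenBelow_ext fun y => by rw [hseen v hv, hseen w hw]
  have hz' : z ∈ held a h w (Nat.pair (z + 1) j + 1) := by
    rw [held_succ_of_isUpdated hu, hn, hseen w hw]
    exact ⟨z.lt_succ_self, hzS⟩
  have := hw.1.2 _ z hz'
  omega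

/-- A large number can enter only through an update with a large cutoff. If this happens after `y`
has been seen, the same update also brings in `y`. -/
theorem exists_mem_held_of_unbounded (ha : IsMonotoneApprox a) {w : ℕ → Bool}
    (hw : ∀ N, ∃ i, ∃ y ∈ held a h w i, N ≤ y) {y : ℕ} (hy : y ∈ seenSet a w) :
    ∃ i, y ∈ held a h w i := by
  obtain ⟨j, hj⟩ := eventually_mem_seenBelow ha hy
  obtain ⟨N, hN⟩ : ∃ N, ∀ x ∈ held a h w j, x < N :=
    ⟨(held a h w j).sum + 1, fun x hx => Nat.lt_succ_of_le (List.le_sum_of_mem hx)⟩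
  classical
  -- At the first time an element this large is held, `N` forces the time to be after `j`, and `y +
  -- 1` forces the cutoff above `y`.
  have hex := hw (max N (y + 1))
  obtain ⟨x, hx, hNx⟩ := Nat.find_spec hex
  have hjlt : j < Nat.find hex := by
    by_contra hle
    have := hN x (held_subset ha w (not_lt.1 hle) hx)
    omega
  obtain ⟨i, hi⟩ : ∃ i, Nat.find hex = i + 1 := ⟨Nat.find hex - 1, by omega⟩
  rw [hi] at hx
  have hu : IsUpdated a h w i := by
    by_contra hu
    rw [held_succ_of_not_isUpdated hu] at hx
    exact Nat.find_min hex (by omega) ⟨x, hx, hNx⟩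
  refine ⟨i + 1, ?_⟩
  rw [held_succ_of_isUpdated hu] at hx ⊢
  have := (mem_seenBelow.1 hx).1
  exact hj i (by omega) _ (by omega)

/-! ### Matching held-back sets by deterministic inputs -/

variable {d : ℕ → List Bool × ℕ → Option ℕ}

/-- The numbers seen eventually on the input `x`. -/
def outputSet (d : ℕ → List Bool × ℕ → Option ℕ) (x : List Bool) : Set ℕ :=
  {y | ∃ i t, d i (x, t) = some y}

/-- The list of numbers seen on the input `x` at the time `u`. -/
def outputsAt (d : ℕ → List Bool × ℕ → Option ℕ) (x : List Bool) (u : ℕ) : List ℕ :=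
  (List.range (u + 1)).filterMap fun t => d u (x, t)

theorem mem_outputsAt {x : List Bool} {u y : ℕ} :
    y ∈ outputsAt d x u ↔ ∃ t ≤ u, d u (x, t) = some y := by
  simp [outputsAt]

theorem matchedBy_iff {k u : ℕ} {b : List ℕ} :
    MatchedBy d k u b ↔
      ∃ x : List Bool, x.length ≤ k ∧ ∃ u' ≤ u, ∀ y, y ∈ outputsAt d x u' ↔ y ∈ b := by
  simp only [MatchedBy, List.mem_flatMap, List.mem_range, mem_words, Nat.lt_succ_iff]
  constructor
  · rintro ⟨x, ⟨_, hk, rfl⟩, u', hu', h1, h2⟩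
    exact ⟨x, hk, u', hu', fun y => ⟨h1 y, h2 y⟩⟩
  · rintro ⟨x, hk, u', hu', hb⟩
    exact ⟨x, ⟨_, hk, rfl⟩, u', hu', fun y => (hb y).1, fun y => (hb y).2⟩

/-- The exact set seen on an input may change later; monotonicity holds because the match may occur
at any earlier time. -/
theorem MatchedBy.mono {k u v : ℕ} {b : List ℕ} (hb : MatchedBy d k u b) (huv : u ≤ v) :
    MatchedBy d k v b := by
  rw [matchedBy_iff] at hb ⊢
  obtain ⟨x, hx, u', hu', h⟩ := hb
  exact ⟨x, hx, u', hu'.trans huv, h⟩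

theorem outputsAt_mono (hd : IsMonotoneApprox d) {x : List Bool} {u v y : ℕ} (huv : u ≤ v)
    (hy : y ∈ outputsAt d x u) : y ∈ outputsAt d x v := by
  obtain ⟨t, ht, h⟩ := mem_outputsAt.1 hy
  exact mem_outputsAt.2 ⟨t, ht.trans huv, hd _ _ _ _ huv h⟩

theorem eventually_mem_outputsAt (hd : IsMonotoneApprox d) {x : List Bool} {y : ℕ}
    (hy : y ∈ outputSet d x) : ∃ u, y ∈ outputsAt d x u := by
  obtain ⟨i, t, h⟩ := hy
  exact ⟨max i t, mem_outputsAt.2 ⟨t, le_max_right _ _, hd _ _ _ _ (le_max_left _ _) h⟩⟩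

theorem outputsAt_subset {x : List Bool} {u y : ℕ} (hy : y ∈ outputsAt d x u) :
    y ∈ outputSet d x := by
  obtain ⟨t, _, h⟩ := mem_outputsAt.1 hy
  exact ⟨u, t, h⟩

/-- A finite set which is the set of all numbers seen on an input is matched at some time. -/
theorem exists_matchedBy (hd : IsMonotoneApprox d) {x : List Bool} {b : List ℕ}
    (hb : ∀ y, y ∈ outputSet d x ↔ y ∈ b) {k : ℕ} (hk : x.length ≤ k) :
    ∃ u, MatchedBy d k u b := by
  have : ∀ y, ∃ u, y ∈ b → y ∈ outputsAt d x u := by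
    intro y
    by_cases hy : y ∈ b
    · obtain ⟨u, hu⟩ := eventually_mem_outputsAt hd ((hb y).2 hy)
      exact ⟨u, fun _ => hu⟩
    · exact ⟨0, fun h => absurd h hy⟩
  choose u hu using this
  refine ⟨b.toFinset.sup u, matchedBy_iff.2 ⟨x, hk, _, le_rfl, fun y => ⟨fun hy => ?_, fun hy => ?_⟩⟩⟩
  · exact (hb y).1 (outputsAt_subset hy)
  · exact outputsAt_mono hd (Finset.le_sup (f := u) (List.mem_toFinset.2 hy)) (hu y hy)

/-- If all held-back outputs are matched and unbounded, then a single input of bounded length gives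
their limit. -/
theorem exists_outputSet_eq (ha : IsMonotoneApprox a) (hd : IsMonotoneApprox d) {k : ℕ}
    {w : ℕ → Bool} (hw : ∀ N, ∃ i, ∃ y ∈ held a h w i, N ≤ y)
    (hm : ∀ i, ∃ u, MatchedBy d k u (held a h w i)) :
    ∃ x : List Bool, x.length ≤ k ∧ outputSet d x = seenSet a w := by
  have hm' : ∀ i, ∃ x : List Bool, x.length ≤ k ∧
      ∃ u, ∀ y, y ∈ outputsAt d x u ↔ y ∈ held a h w i := by
    intro i
    obtain ⟨u, hu⟩ := hm i
    obtain ⟨x, hx, u', -, h'⟩ := matchedBy_iff.1 hu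
    exact ⟨x, hx, u', h'⟩
  choose x hx u hu using hm'
  have hfin : {x : List Bool | x.length ≤ k}.Finite := List.finite_length_le Bool k
  -- Pigeonhole: one of the finitely many short inputs matches for arbitrarily large `i`.
  obtain ⟨x₀, hx₀, hinf⟩ : ∃ x₀, x₀.length ≤ k ∧ ∀ j, ∃ i ≥ j, x i = x₀ := by
    by_contra! hcon
    choose! j hj using hcon
    let J := hfin.toFinset.sup j
    refine hj (x J) (hx J) J ?_ rfl
    exact Finset.le_sup (f := j) (hfin.mem_toFinset.2 (hx J))
  refine ⟨x₀, hx₀, Set.Subset.antisymm (fun y hy => ?_) (fun y hy => ?_)⟩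
  · obtain ⟨v, hv⟩ := eventually_mem_outputsAt hd hy
    -- A held number above everything output by time `v` forces the later matching times beyond `v`,
    -- so whatever is output by time `v` lies in a held set.
    obtain ⟨j, z, hz, hzv⟩ := hw ((outputsAt d x₀ v).sum + 1)
    obtain ⟨i, hi, hxi⟩ := hinf j
    have hzi := (hu i z).2 (held_subset ha w hi hz)
    rw [hxi] at hzi
    have hvu : v ≤ u i := by
      by_contra hlt
      have := List.le_sum_of_mem (outputsAt_mono hd (not_le.1 hlt).le hzi)
      omega
    refine held_subset_seenSet (h := h) ha ((hu i y).1 ?_)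
    rw [hxi]
    exact outputsAt_mono hd hvu hv
  · obtain ⟨j, hj⟩ := exists_mem_held_of_unbounded ha hw hy
    obtain ⟨i, hi, hxi⟩ := hinf j
    have := (hu i y).2 (held_subset ha w hi hj)
    rw [hxi] at this
    exact outputsAt_subset this

/-! ### Stages -/

theorem stage_le_succ (k u : ℕ) : stage a d h k u ≤ stage a d h k (u + 1) := by
  rw [stage]
  split_ifs <;> omega

theorem stage_mono (k : ℕ) : Monotone (stage a d h k) :=
  monotone_nat_of_le_succ (stage_le_succ k)

/-- Stages advance one at a time, so each smaller stage has been left, which required all its sets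
to be matched. -/
theorem exists_matchedBy_of_lt_stage {k u i : ℕ} (hi : i < stage a d h k u) (w : ℕ → Bool) :
    ∃ u', MatchedBy d k u' (held a h w i) := by
  induction u with
  | zero => simp [stage] at hi
  | succ u ih =>
    by_cases hlt : i < stage a d h k u
    · exact ih hlt
    · rw [stage] at hi
      split_ifs at hi with hc
      · have : i = stage a d h k u := by omega
        subst this
        exact ⟨u, hc _ (mem_table_iff.2 ⟨w, rfl⟩)⟩
      · omega

/-- At a stage that is never left, some held-back output is never matched. -/
theorem exists_not_matchedBy {k i u₀ : ℕ} (hi : ∀ u ≥ u₀, stage a d h k u = i) :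
    ∃ w, ∀ u, ¬ MatchedBy d k u (held a h w i) := by
  by_contra! hcon
  have : ∀ p : List Bool × List ℕ, ∃ u, p ∈ table a h i → MatchedBy d k u p.2 := by
    intro p
    by_cases hp : p ∈ table a h i
    · obtain ⟨w, rfl⟩ := mem_table_iff.1 hp
      obtain ⟨u, hu⟩ := hcon w
      exact ⟨u, fun _ => hu⟩
    · exact ⟨0, fun h => absurd h hp⟩
  choose u hu using this
  -- By this time all sets of the finite table are matched, so the stage would be left.
  let v := max u₀ ((table a h i).toFinset.sup u)
  have h1 : stage a d h k v = i := hi v (le_max_left _ _)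
  have h2 : stage a d h k (v + 1) = i := hi _ ((le_max_left _ _).trans v.le_succ)
  rw [stage, h1, if_pos] at h2
  · omega
  · exact fun p hp => (hu p hp).mono
      ((Finset.le_sup (f := u) (List.mem_toFinset.2 hp)).trans (le_max_right _ _))

/-- At a stage that is never left, some held-back output that is never matched has a large
probability. -/
theorem exists_words_of_stage_eq {k i u₀ : ℕ} (hi : ∀ u ≥ u₀, stage a d h k u = i) :
    ∃ b : List ℕ, (∀ u, ¬ MatchedBy d k u b) ∧
      ∃ (j : ℕ) (L : List (List Bool)), L.Nodup ∧ (∀ σ ∈ L, σ.length = j) ∧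
        2 ^ j ≤ 2 ^ (h + 1) * L.length ∧ ∀ v, bitPrefix v j ∈ L → held a h v i = b := by
  obtain ⟨w, hw⟩ := exists_not_matchedBy hi
  refine ⟨held a h w i, hw, ?_⟩
  cases i with
  -- The initial empty set belongs to the empty word, hence has probability one.
  | zero => exact ⟨0, [[]], by simp, by simp, by simp [Nat.one_le_two_pow], fun v _ => rfl⟩
  | succ i =>
    have hu : IsUpdated a h w i := by
      by_contra hu
      -- A set that was not updated already stood in the preceding table, whose stage has been left,
      -- so it is matched.
      obtain ⟨u, hm⟩ := exists_matchedBy_of_lt_stage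
        (by rw [hi u₀ le_rfl]; exact i.lt_succ_self : i < stage a d h k u₀) w
      rw [← held_succ_of_not_isUpdated hu] at hm
      exact hw u hm
    exact ⟨i, exists_words_of_isUpdated hu⟩

end Limit

/-! ### Self-delimiting parameters and the emitted set -/

theorem exists_binaryValue_eq (n : ℕ) :
    ∃ q, binaryValue q = n ∧ 2 ^ q.length ≤ max 1 (2 * n) := by
  induction n using Nat.strong_induction_on with
  | _ n ih =>
    rcases Nat.eq_zero_or_pos n with rfl | hn
    · exact ⟨[], rfl, by simp⟩
    · obtain ⟨q, hq, hlen⟩ := ih (n / 2) (by omega)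
      refine ⟨q ++ [decide (n % 2 = 1)], ?_, ?_⟩
      · have : binaryValue (q ++ [decide (n % 2 = 1)]) =
            2 * binaryValue q + (decide (n % 2 = 1)).toNat := by
          simp [binaryValue, List.foldl_append]
        rw [this, hq]
        rcases Nat.mod_two_eq_zero_or_one n with h | h <;> simp [h] <;> omega
      · rw [List.length_append, List.length_singleton, pow_succ]
        omega

/-- The self-delimiting form of `q`. -/
def headerWord (q : List Bool) : List Bool := List.replicate q.length true ++ false :: q

theorem length_headerWord (q : List Bool) : (headerWord q).length = 2 * q.length + 1 := by
  simp [headerWord]; omega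

theorem leadingOnes_replicate_append (l : ℕ) (v : List Bool) :
    leadingOnes (List.replicate l true ++ false :: v) = l := by
  induction l with
  | zero => simp [leadingOnes]
  | succ l ih => simp [leadingOnes, List.replicate_succ]

theorem drop_replicate_append (l : ℕ) (v : List Bool) :
    (List.replicate l true ++ false :: v).drop (l + 1) = v := by
  rw [← List.drop_drop, List.drop_left' (by simp)]
  rfl

theorem header_headerWord_append (q v : List Bool) :
    header (headerWord q ++ v) = (binaryValue q).unpair := by
  rw [header, headerWord, List.append_assoc, List.cons_append, leadingOnes_replicate_append,
    drop_replicate_append, List.take_left]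

theorem payload_headerWord_append (q v : List Bool) : payload (headerWord q ++ v) = v := by
  rw [payload, headerWord, List.append_assoc, List.cons_append, leadingOnes_replicate_append,
    drop_replicate_append, List.drop_left]

/-- An incomplete header may decode to wrong parameters, but with an empty payload the stage is `0`
and nothing is emitted. -/
theorem payload_take_headerWord (q : List Bool) (n : ℕ) : payload ((headerWord q).take n) = [] := by
  rcases Nat.lt_or_ge q.length n with hn | hn
  · obtain ⟨m, rfl⟩ : ∃ m, n = q.length + (m + 1) := ⟨n - q.length - 1, by omega⟩
    have : (headerWord q).take (q.length + (m + 1)) =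
        List.replicate q.length true ++ false :: q.take m := by
      rw [headerWord, List.take_append]
      simp
    rw [payload, this, leadingOnes_replicate_append, drop_replicate_append]
    simp
  · have : (headerWord q).take n = List.replicate n true := by
      rw [headerWord, List.take_append]
      simp [hn]
    rw [payload, this]
    have : leadingOnes (List.replicate n true) = n := by
      induction n with
      | zero => rfl
      | succ n _ => simp [leadingOnes]
    rw [this]
    simp

section Emission

variable {a : ℕ → List Bool → Option ℕ} {d : ℕ → List Bool × ℕ → Option ℕ}

/-- The bits needed at the current stage have thus already been read. -/
theorem stage_le (h k u : ℕ) : stage a d h k u ≤ u := by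
  induction u with
  | zero => simp [stage]
  | succ u ih =>
    rw [stage]
    split_ifs <;> omega

theorem emits_bitPrefix {c : ℕ × ℕ} {v : ℕ → Bool} {u y : ℕ} :
    Emits a d c (bitPrefix v u) y ↔ y ∈ held a c.1 v (stage a d c.1 c.2 u) := by
  rw [Emits, length_bitPrefix, take_bitPrefix v (stage_le _ _ _)]
  constructor
  · rintro ⟨p, hp, h1, h2⟩
    obtain ⟨w, rfl⟩ := mem_table_iff.1 hp
    rwa [← held_congr h1]
  · exact fun hy => ⟨_, mem_table_iff.2 ⟨v, rfl⟩, rfl, hy⟩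

/-- The numbers emitted after the self-delimiting form of a word. -/
theorem exists_emits_iff {q : List Bool} {w : ℕ → Bool} {h k y : ℕ}
    (hq : binaryValue q = Nat.pair h k)
    (hw : bitPrefix w (2 * q.length + 1) = headerWord q) :
    (∃ n, Emits a d (header (bitPrefix w n)) (payload (bitPrefix w n)) y) ↔
      ∃ u, y ∈ held a h (fun j => w (2 * q.length + 1 + j)) (stage a d h k u) := by
  have key : ∀ u, Emits a d (header (bitPrefix w (2 * q.length + 1 + u)))
      (payload (bitPrefix w (2 * q.length + 1 + u))) y ↔
      y ∈ held a h (fun j => w (2 * q.length + 1 + j)) (stage a d h k u) := by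
    intro u
    rw [bitPrefix_add, hw, header_headerWord_append, payload_headerWord_append, hq,
      Nat.unpair_pair, emits_bitPrefix]
  constructor
  · rintro ⟨n, hn⟩
    rcases le_or_gt (2 * q.length + 1) n with hle | hlt
    · obtain ⟨u, rfl⟩ := Nat.exists_eq_add_of_le hle
      exact ⟨u, (key u).1 hn⟩
    · rw [← take_bitPrefix w hlt.le, hw, payload_take_headerWord] at hn
      obtain ⟨p, hp, -, hy⟩ := hn
      simp [stage, table] at hp
      simp [hp] at hy
  · rintro ⟨u, hu⟩
    exact ⟨_, (key u).2 hu⟩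

/-- If a stage is never left, some finite set which is never matched is emitted with a large
probability. -/
theorem exists_le_coinMeasure_of_stage_eq (ha : IsMonotoneApprox a) {q : List Bool} {h k i u₀ : ℕ}
    (hq : binaryValue q = Nat.pair h k) (hi : ∀ u ≥ u₀, stage a d h k u = i) :
    ∃ b : List ℕ, (∀ u, ¬ MatchedBy d k u b) ∧
      (2⁻¹ : ℝ≥0∞) ^ (2 * q.length + 1 + (h + 1)) ≤
        coinMeasure {w | {y | ∃ n, Emits a d (header (bitPrefix w n)) (payload (bitPrefix w n)) y} =
          {y | y ∈ b}} := by
  obtain ⟨b, hb, j, L, hnd, hlen, hcard, hL⟩ := exists_words_of_stage_eq hi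
  refine ⟨b, hb, ?_⟩
  have hlen' : ∀ σ ∈ L.map (headerWord q ++ ·), σ.length = 2 * q.length + 1 + j := by
    intro σ hσ
    obtain ⟨τ, hτ, rfl⟩ := List.mem_map.1 hσ
    rw [List.length_append, length_headerWord, hlen τ hτ]
  have hmeas := coinMeasure_bitPrefix_mem
    (hnd.map fun _ _ h => List.append_cancel_left h) hlen'
  have hsub : {w | bitPrefix w (2 * q.length + 1 + j) ∈ L.map (headerWord q ++ ·)} ⊆
      {w | {y | ∃ n, Emits a d (header (bitPrefix w n)) (payload (bitPrefix w n)) y} =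
          {y | y ∈ b}} := by
    intro w hw
    obtain ⟨τ, hτ, hwτ⟩ := List.mem_map.1 hw
    rw [bitPrefix_add] at hwτ
    obtain ⟨h1, h2⟩ := List.append_inj hwτ (by simp [length_headerWord])
    rw [h2] at hτ
    have hheld := hL _ hτ
    ext y
    simp only [Set.mem_ofPred_eq]
    rw [exists_emits_iff hq h1.symm, ← hheld]
    constructor
    -- Held sets grow and the stage settles at `i`, so everything emitted lies in the set of stage
    -- `i`.
    · rintro ⟨u, hu⟩
      rw [← hi (max u u₀) (le_max_right _ _)]
      exact held_subset ha _ (stage_mono k (le_max_left _ _)) hu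
    · intro hy
      exact ⟨u₀, by rwa [hi u₀ le_rfl]⟩
  refine le_trans ?_ (measure_mono hsub)
  rw [hmeas, List.length_map]
  have h3 : (2⁻¹ : ℝ≥0∞) ^ (h + 1) * 2 ^ (h + 1) = 1 := by
    rw [← mul_pow, ENNReal.inv_mul_cancel (by simp) (by simp), one_pow]
  have h4 : (2⁻¹ : ℝ≥0∞) ^ j * 2 ^ j = 1 := by
    rw [← mul_pow, ENNReal.inv_mul_cancel (by simp) (by simp), one_pow]
  have h5 : (2 : ℝ≥0∞) ^ j ≤ 2 ^ (h + 1) * L.length := by exact_mod_cast hcard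
  calc (2⁻¹ : ℝ≥0∞) ^ (2 * q.length + 1 + (h + 1))
      = 2⁻¹ ^ (2 * q.length + 1) * 2⁻¹ ^ (h + 1) * (2⁻¹ ^ j * 2 ^ j) := by
        rw [h4, mul_one, pow_add]
    _ ≤ 2⁻¹ ^ (2 * q.length + 1) * 2⁻¹ ^ (h + 1) * (2⁻¹ ^ j * (2 ^ (h + 1) * L.length)) := by
        gcongr
    _ = (2⁻¹ ^ (h + 1) * 2 ^ (h + 1)) * (L.length * 2⁻¹ ^ (2 * q.length + 1 + j)) := by
        rw [pow_add _ (2 * q.length + 1) j]; ring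
    _ = _ := by rw [h3, one_mul]

end Emission

/-! ### Numerical bounds -/

theorem Real.logb_two_le_sub_one {y : ℝ} (hy : 2 ≤ y) : Real.logb 2 y ≤ y - 1 := by
  rw [Real.logb_le_iff_le_rpow (by norm_num) (by linarith)]
  -- Bernoulli's inequality for `(1 + 1) ^ (y - 1)`.
  have := one_add_mul_self_le_rpow_one_add (s := (1 : ℝ)) (by norm_num) (p := y - 1) (by linarith)
  norm_num at this
  exact this

/-- The choice is circular: `C'` determines `k`, and `k` must be written in the header of length `2
* l + 1`. But `C'` enters `l` only logarithmically. With `C' + α + 1 = t ^ 2` the header costs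
`O(t)` times the logarithm of `h₀ + 2`, which the quadratic `C'` absorbs for large `t`. -/
theorem exists_bound_const {α C c : ℝ} (hα : 1 ≤ α) (hC : 0 ≤ C) (hc : 0 ≤ c) :
    ∃ C' : ℝ, 0 ≤ C' ∧ ∀ h₀ : ℝ, 0 ≤ h₀ → ∀ l k : ℕ,
      k = ⌊α * h₀ + C' * Real.logb 2 (h₀ + 2)⌋₊ → 2 ^ l ≤ max 1 (2 * Nat.pair ⌈h₀⌉₊ k) →
      α * (2 * l + ⌈h₀⌉₊ + 2 + c) + C * Real.logb 2 (2 * l + ⌈h₀⌉₊ + 2 + c + 2) ≤ k := by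
  obtain ⟨t, ht⟩ : ∃ t, t = (α + C) * 8 + (α + C) * (9 + c) + C + α + 2 := ⟨_, rfl⟩
  have hαC : 0 ≤ (α + C) * (9 + c) := by positivity
  have ht2 : 2 ≤ t := by linarith
  have hbig : (α + C) * (9 + c + 8 * t) + C + 1 ≤ t ^ 2 - α - 1 := by
    have : ((α + C) * (9 + c) + C + α + 2) * 1 ≤ ((α + C) * (9 + c) + C + α + 2) * t :=
      mul_le_mul_of_nonneg_left (by linarith) (by linarith)
    have h2 : t ^ 2 = t * ((α + C) * 8 + (α + C) * (9 + c) + C + α + 2) := by rw [← ht, sq]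
    rw [h2]
    linarith
  have hC' : 0 ≤ t ^ 2 - α - 1 := by
    have : 0 ≤ (α + C) * (9 + c + 8 * t) := by positivity
    linarith
  refine ⟨t ^ 2 - α - 1, hC', fun h₀ hh l k hk hl => ?_⟩
  obtain ⟨C', hC'eq⟩ : ∃ C', C' = t ^ 2 - α - 1 := ⟨_, rfl⟩
  rw [← hC'eq] at hk hC' hbig
  obtain ⟨x, hx⟩ : ∃ x, x = Real.logb 2 (h₀ + 2) := ⟨_, rfl⟩
  rw [← hx] at hk
  have hx1 : 1 ≤ x := by
    rw [hx, Real.le_logb_iff_rpow_le (by norm_num) (by linarith)]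
    norm_num
    exact hh
  have hxh : x ≤ h₀ + 1 := by
    have := Real.logb_two_le_sub_one (y := h₀ + 2) (by linarith)
    linarith
  have hH : (⌈h₀⌉₊ : ℝ) ≤ h₀ + 1 := (Nat.ceil_lt_add_one hh).le
  have hC'x : 0 ≤ C' * x := by positivity
  have hαh : h₀ ≤ α * h₀ := by nlinarith
  have hk1 : (k : ℝ) ≤ α * h₀ + C' * x := by
    rw [hk]
    exact Nat.floor_le (by linarith)
  have hk2 : α * h₀ + C' * x - 1 ≤ k := by
    rw [hk]
    have := Nat.lt_floor_add_one (α * h₀ + C' * x)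
    linarith
  have hmax : (max ⌈h₀⌉₊ k : ℕ) + 1 ≤ t ^ 2 * (h₀ + 2) := by
    have h1 : ((max ⌈h₀⌉₊ k : ℕ) : ℝ) ≤ α * h₀ + C' * x + 1 := by
      rw [Nat.cast_max]
      exact max_le (by linarith) (by linarith)
    have h2 : C' * x ≤ C' * (h₀ + 2) := mul_le_mul_of_nonneg_left (by linarith) hC'
    have h3 : t ^ 2 = C' + α + 1 := by linarith
    rw [h3]
    nlinarith
  have hlr : (2 : ℝ) ^ l ≤ 2 * (t ^ 2 * (h₀ + 2)) ^ 2 := by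
    have h1 : 2 ^ l ≤ 2 * (max ⌈h₀⌉₊ k + 1) ^ 2 := by
      have := Nat.pair_lt_max_add_one_sq ⌈h₀⌉₊ k
      omega
    calc (2 : ℝ) ^ l ≤ 2 * ((max ⌈h₀⌉₊ k : ℕ) + 1) ^ 2 := by exact_mod_cast h1
      _ ≤ _ := by gcongr
  have hll : (l : ℝ) ≤ 1 + 2 * (2 * t + x) := by
    have h1 : (l : ℝ) ≤ Real.logb 2 (2 * (t ^ 2 * (h₀ + 2)) ^ 2) := by
      rw [Real.le_logb_iff_rpow_le (by norm_num) (by positivity), Real.rpow_natCast]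
      exact hlr
    have h2 : Real.logb 2 (2 * (t ^ 2 * (h₀ + 2)) ^ 2) = 1 + 2 * (2 * Real.logb 2 t + x) := by
      rw [Real.logb_mul (by norm_num) (by positivity), Real.logb_pow,
        Real.logb_mul (by positivity) (by positivity), Real.logb_pow, hx]
      norm_num
    have h3 := Real.logb_two_le_sub_one ht2
    linarith
  -- Collects `2 * l ≤ 2 + 8 * t + 4 * x`, `⌈h₀⌉₊ ≤ h₀ + 1` and `2 + c`, with constants absorbed by
  -- `1 ≤ x`.
  obtain ⟨K, hK⟩ : ∃ K, K = 9 + c + 8 * t := ⟨_, rfl⟩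
  rw [← hK] at hbig
  have hK2 : 1 ≤ K := by linarith
  have hsum : 2 * (l : ℝ) + ⌈h₀⌉₊ + 2 + c ≤ h₀ + K * x := by
    have : (5 + c + 8 * t) * 1 ≤ (5 + c + 8 * t) * x :=
      mul_le_mul_of_nonneg_left hx1 (by linarith)
    rw [hK]
    linarith
  have hlog : Real.logb 2 (2 * l + ⌈h₀⌉₊ + 2 + c + 2) ≤ (K + 1) * x := by
    have h1 : 2 * (l : ℝ) + ⌈h₀⌉₊ + 2 + c + 2 ≤ (1 + K) * (h₀ + 2) := by
      have : K * x ≤ K * (h₀ + 2) := mul_le_mul_of_nonneg_left (by linarith) (by linarith)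
      linarith
    have h2 : Real.logb 2 (2 * l + ⌈h₀⌉₊ + 2 + c + 2) ≤ Real.logb 2 ((1 + K) * (h₀ + 2)) :=
      Real.logb_le_logb_of_le (by norm_num) (by positivity) h1
    rw [Real.logb_mul (by positivity) (by positivity), ← hx] at h2
    have h3 := Real.logb_two_le_sub_one (y := 1 + K) (by linarith)
    have h4 : K * 1 ≤ K * x := mul_le_mul_of_nonneg_left hx1 (by linarith)
    linarith
  have h1 : α * (2 * l + ⌈h₀⌉₊ + 2 + c) ≤ α * (h₀ + K * x) :=
    mul_le_mul_of_nonneg_left hsum (by linarith)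
  have h2 : C * Real.logb 2 (2 * l + ⌈h₀⌉₊ + 2 + c + 2) ≤ C * ((K + 1) * x) :=
    mul_le_mul_of_nonneg_left hlog hC
  -- The summand `1` pays for rounding `k` down.
  have h3 : ((α + C) * K + C + 1) * x ≤ C' * x := mul_le_mul_of_nonneg_right hbig (by linarith)
  linarith

/-! ### Complexities and probabilities -/

namespace EnumMachine

/-- A nonempty infimum in `ℕ∞` is attained; over the empty family it is `⊤`. -/
theorem complexity_le_iff {D : EnumMachine} {S : Set ℕ} {k : ℕ} :
    D.complexity S ≤ k ↔ ∃ x : List Bool, x.length ≤ k ∧ D.enumerated x = S := by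
  constructor
  · intro hk
    have hne : Nonempty {x : List Bool // D.enumerated x = S} := by
      by_contra hne
      rw [not_nonempty_iff] at hne
      rw [complexity, iInf_of_empty] at hk
      exact absurd hk (by simp)
    obtain ⟨x, hx⟩ := ENat.exists_eq_iInf
      (fun x : {x : List Bool // D.enumerated x = S} => (x.1.length : ℕ∞))
    rw [complexity, ← hx] at hk
    exact ⟨x.1, by exact_mod_cast hk, x.2⟩
  · rintro ⟨x, hx, hS⟩
    exact (iInf_le _ ⟨x, hS⟩).trans (by exact_mod_cast hx)

theorem coe_complexity_le_iff {D : EnumMachine} {S : Set ℕ} {k : ℕ} :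
    ((D.complexity S : ℝ≥0∞) : EReal) ≤ ((k : ℝ) : EReal) ↔ D.complexity S ≤ k := by
  cases D.complexity S with
  | top => simp [EReal.natCast_ne_top]
  | coe n =>
    have : (((n : ℕ∞) : ℝ≥0∞) : EReal) = ((n : ℝ) : EReal) := by
      rw [ENat.toENNReal_coe, ← ENNReal.coe_natCast]
      rfl
    rw [this, EReal.coe_le_coe_iff, Nat.cast_le, Nat.cast_le]

end EnumMachine

namespace ProbEnumMachine

theorem prob_le_one (M : ProbEnumMachine) (S : Set ℕ) : M.prob S ≤ 1 :=
  MeasureTheory.prob_le_one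

theorem complexity_nonneg (M : ProbEnumMachine) (S : Set ℕ) : 0 ≤ M.complexity S := by
  rw [complexity]
  split_ifs with h
  · simp
  · have h1 : (M.prob S).toReal ≤ 1 := ENNReal.toReal_le_of_le_ofReal (by norm_num)
      (by simpa using M.prob_le_one S)
    have := Real.logb_nonpos (b := 2) (by norm_num) ENNReal.toReal_nonneg h1
    exact_mod_cast neg_nonneg.2 this

theorem toReal_two_inv_pow (n : ℕ) : ((2⁻¹ : ℝ≥0∞) ^ n).toReal = (2 : ℝ) ^ (-(n : ℝ)) := by
  rw [Real.rpow_neg (by norm_num), Real.rpow_natCast]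
  simp

theorem complexity_le_of_le_prob {M : ProbEnumMachine} {S : Set ℕ} {n : ℕ}
    (h : (2⁻¹ : ℝ≥0∞) ^ n ≤ M.prob S) : M.complexity S ≤ ((n : ℝ) : EReal) := by
  have hpos : (0 : ℝ≥0∞) < 2⁻¹ ^ n := ENNReal.pow_pos (by simp) n
  have hne : M.prob S ≠ 0 := (hpos.trans_le h).ne'
  rw [complexity, if_neg hne, EReal.coe_le_coe_iff, neg_le]
  have hfin : M.prob S ≠ ⊤ := ((M.prob_le_one S).trans_lt ENNReal.one_lt_top).ne
  rw [Real.le_logb_iff_rpow_le (by norm_num) (ENNReal.toReal_pos hne hfin), ← toReal_two_inv_pow]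
  exact ENNReal.toReal_mono hfin h

theorem lt_prob_of_complexity_eq {M : ProbEnumMachine} {S : Set ℕ} {h : ℝ}
    (hS : M.complexity S = (h : EReal)) {n : ℕ} (hn : h < n) : (2⁻¹ : ℝ≥0∞) ^ n < M.prob S := by
  rw [complexity] at hS
  split_ifs at hS with hne
  · exact absurd hS (by simp)
  · have hfin : M.prob S ≠ ⊤ := ((M.prob_le_one S).trans_lt ENNReal.one_lt_top).ne
    have hlog : -(n : ℝ) < Real.logb 2 (M.prob S).toReal := by
      have : -Real.logb 2 (M.prob S).toReal = h := by exact_mod_cast hS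
      linarith
    rw [Real.lt_logb_iff_rpow_lt (by norm_num) (ENNReal.toReal_pos hne hfin),
      ← toReal_two_inv_pow] at hlog
    exact (ENNReal.toReal_lt_toReal (by simp) hfin).1 hlog

end ProbEnumMachine

/-! ### The transfer from finite to infinite sets -/

theorem theorem3 (D : EnumMachine) (hD : D.IsUniversal)
    (M : ProbEnumMachine) (hM : M.IsOptimal) (α : ℝ) (hα : 1 ≤ α)
    (hfin : ∃ C : ℝ, ∀ S : Set ℕ, S.Finite → ∀ h : ℝ, M.complexity S = (h : EReal) →
      ((D.complexity S : ℝ≥0∞) : EReal) ≤ ((α * h + C * Real.logb 2 (h + 2) : ℝ) : EReal)) :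
    ∃ C : ℝ, ∀ S : Set ℕ, S.Infinite → ∀ h : ℝ, M.complexity S = (h : EReal) →
      ((D.complexity S : ℝ≥0∞) : EReal) ≤ ((α * h + C * Real.logb 2 (h + 2) : ℝ) : EReal) := by
  obtain ⟨C, hC⟩ := hfin
  obtain ⟨a, hap, ha, hae⟩ := M.computable_outputAfter.exists_primrec_approx
  obtain ⟨d, hdp, hd, hde⟩ := D.computable_output.exists_primrec_approx
  have hseen : ∀ w, seenSet a w = M.enumerated w := by
    intro w
    ext y
    simp only [seenSet, ProbEnumMachine.enumerated, Set.mem_ofPred_eq,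
      ← M.outputAfter_bitPrefix, hae]
    exact exists_comm
  have hout : ∀ x, outputSet d x = D.enumerated x := by
    intro x
    ext y
    simp only [outputSet, EnumMachine.enumerated, Set.mem_ofPred_eq]
    rw [exists_comm]
    exact exists_congr fun t => (hde (x, t) y).symm
  obtain ⟨P, hP⟩ := ProbEnumMachine.exists_enumerated_eq (primrecRel_emits hap hdp)
  -- `P` reads `h` and `k` from its random bits, so `c` does not depend on `S`.
  obtain ⟨c, hc⟩ := hM P
  -- `C` and `c` may be negative; the monotonicity estimates need nonnegative constants.
  obtain ⟨C', hC'0, hC'⟩ := exists_bound_const hα (le_max_right C 0) (le_max_right c 0)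
  refine ⟨C', fun S hS h₀ hh₀ => ?_⟩
  have hh0 : 0 ≤ h₀ := by
    have := M.complexity_nonneg S
    rw [hh₀] at this
    exact_mod_cast this
  obtain ⟨k, hk⟩ : ∃ k, k = ⌊α * h₀ + C' * Real.logb 2 (h₀ + 2)⌋₊ := ⟨_, rfl⟩
  obtain ⟨q, hq, hql⟩ := exists_binaryValue_eq (Nat.pair ⌈h₀⌉₊ k)
  have hbound := hC' h₀ hh0 q.length k hk hql
  -- Only here is the assumption on finite sets used: a finite set likely for `P` has small `H`,
  -- hence a description of length at most `k`, and so is matched.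
  have hfinite : ∀ b : List ℕ, (2⁻¹ : ℝ≥0∞) ^ (2 * q.length + 1 + (⌈h₀⌉₊ + 1)) ≤
      P.prob {y | y ∈ b} → ∃ u, MatchedBy d k u b := by
    intro b hb
    have hMb : M.complexity {y | y ∈ b} ≤
        ((2 * q.length + ⌈h₀⌉₊ + 2 + max c 0 : ℝ) : EReal) := by
      calc M.complexity {y | y ∈ b} ≤ P.complexity {y | y ∈ b} + (c : EReal) := hc _
        _ ≤ (((2 * q.length + 1 + (⌈h₀⌉₊ + 1) : ℕ) : ℝ) : EReal) + ((max c 0 : ℝ) : EReal) :=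
          add_le_add (ProbEnumMachine.complexity_le_of_le_prob hb)
            (EReal.coe_le_coe_iff.2 (le_max_left _ _))
        _ = _ := by
          rw [← EReal.coe_add]
          congr 1
          push_cast
          ring
    have hM0 := M.complexity_nonneg {y | y ∈ b}
    obtain ⟨hF, hhF⟩ : ∃ r : ℝ, M.complexity {y | y ∈ b} = (r : EReal) :=
      ⟨_, (EReal.coe_toReal (ne_top_of_le_ne_top (EReal.coe_ne_top _) hMb)
        (ne_bot_of_le_ne_bot (by simp) hM0)).symm⟩
    rw [hhF] at hMb hM0
    have hF0 : 0 ≤ hF := by exact_mod_cast hM0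
    have hF1 := EReal.coe_le_coe_iff.1 hMb
    have hle : α * hF + C * Real.logb 2 (hF + 2) ≤ k := by
      have h1 : α * hF ≤ α * (2 * q.length + ⌈h₀⌉₊ + 2 + max c 0) :=
        mul_le_mul_of_nonneg_left hF1 (by linarith)
      have h2 : Real.logb 2 (hF + 2) ≤
          Real.logb 2 (2 * q.length + ⌈h₀⌉₊ + 2 + max c 0 + 2) :=
        Real.logb_le_logb_of_le (by norm_num) (by linarith) (by linarith)
      have h3 : 0 ≤ Real.logb 2 (hF + 2) := Real.logb_nonneg (by norm_num) (by linarith)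
      have h4 : C * Real.logb 2 (hF + 2) ≤ max C 0 * Real.logb 2 (hF + 2) :=
        mul_le_mul_of_nonneg_right (le_max_left _ _) h3
      have h5 : max C 0 * Real.logb 2 (hF + 2) ≤ max C 0 *
          Real.logb 2 (2 * q.length + ⌈h₀⌉₊ + 2 + max c 0 + 2) :=
        mul_le_mul_of_nonneg_left h2 (le_max_right _ _)
      linarith
    have hDk := (hC {y | y ∈ b} b.finite_toSet hF hhF).trans (EReal.coe_le_coe_iff.2 hle)
    obtain ⟨x, hx, hxb⟩ :=
      EnumMachine.complexity_le_iff.1 (EnumMachine.coe_complexity_le_iff.1 hDk)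
    exact exists_matchedBy hd (fun y => by rw [hout, hxb]; rfl) hx
  have hstage : ∀ i, ∃ u, i < stage a d ⌈h₀⌉₊ k u := by
    by_contra! hcon
    obtain ⟨B, hB⟩ := hcon
    -- A bounded monotone sequence of stages is eventually constant, so some likely set would never
    -- be matched.
    obtain ⟨u₀, hu₀⟩ := WellFoundedGT.monotone_chain_condition'
      (α := Fin (B + 1)) ⟨fun u => ⟨stage a d ⌈h₀⌉₊ k u, Nat.lt_succ_of_le (hB u)⟩,
        fun u v huv => stage_mono k huv⟩
    have hi : ∀ u ≥ u₀, stage a d ⌈h₀⌉₊ k u = stage a d ⌈h₀⌉₊ k u₀ := by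
      intro u hu
      have h1 := hu₀ u hu
      have h2 : stage a d ⌈h₀⌉₊ k u₀ ≤ stage a d ⌈h₀⌉₊ k u := stage_mono k hu
      exact le_antisymm (not_lt.1 h1) h2
    obtain ⟨b, hb, hmeas⟩ := exists_le_coinMeasure_of_stage_eq ha hq hi
    obtain ⟨u, hu⟩ := hfinite b (by
      rw [ProbEnumMachine.prob]
      simpa only [hP] using hmeas)
    exact hb u hu
  -- The extra `1` in the exponent makes the inequality strict, as continuity from below requires.
  have hpS : (2⁻¹ : ℝ≥0∞) ^ (⌈h₀⌉₊ + 1) < coinMeasure {w | seenSet a w = S} := by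
    simp only [hseen]
    refine ProbEnumMachine.lt_prob_of_complexity_eq hh₀ ?_
    push_cast
    linarith [Nat.le_ceil h₀]
  obtain ⟨w, hwS, hw⟩ := exists_held_unbounded ha hS hpS
  obtain ⟨x, hx, hxS⟩ := exists_outputSet_eq ha hd (k := k) hw fun i => by
    obtain ⟨u, hu⟩ := hstage i
    exact exists_matchedBy_of_lt_stage hu w
  have hDS : D.complexity S ≤ k :=
    EnumMachine.complexity_le_iff.2 ⟨x, hx, by rw [← hout, hxS, hwS]⟩
  refine (EnumMachine.coe_complexity_le_iff.2 hDS).trans (EReal.coe_le_coe_iff.2 ?_)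
  rw [hk]
  refine Nat.floor_le ?_
  have : 0 ≤ Real.logb 2 (h₀ + 2) := Real.logb_nonneg (by norm_num) (by linarith)
  positivity
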